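/- \textbf{Parallel random circuits.} A layer on $n$ qubits is sampled as follows: choose a uniformly random maximum matching of the complete graph on $\{1,\dots,n\}$ (at most one vertex is unmatched) and apply, independently for every matched pair, a random two-qubit gate to that pair. The gate is either Haar distributed on the two-qubit unitary group or uniformly distributed on the two-qubit Clifford group (the normalizer of the Pauli group, modulo global phases); the statement holds for both choices. The parallel random circuit of depth $t$ is the product $U$ of $t$ independent layers. \textbf{Setting.} Let $Q$ be a set of $m$ of the $n$ qubits (the message). Initially these are maximally entangled with an $m$-qubit reference $M$, and the other $n-m$ qubits are maximally entangled with an $(n-m)$-qubit system $A$ (entanglement assistance). The circuit $U$ is applied to the $n$ qubits. For a set $T$ of output qubits, $\rho_{MT}$ is the partial trace of the output state over $A$ and over the qubits outside $T$, and $\|\cdot\|_1$ is the trace norm. \textbf{Support chain.} Let $(S_t)_{t\ge 0}$ be the Markov chain on subsets of $\{1,\dots,n\}$ in which, at each step, a uniformly random maximum matching is chosen and its pairs $\{i,j\}$ are updated independently: if $i,j\notin S_t$, then $i,j\notin S_{t+1}$; otherwise, with probability $9/15$ both $i,j\in S_{t+1}$, with probability $3/15$ only $i\in S_{t+1}$,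 and with probability $3/15$ only $j\in S_{t+1}$. An unmatched vertex keeps its membership. \textbf{Theorem.} (1) There are constants $K$, $f_0>0$ and $C$ such that for all $f\le f_0$, all $n\ge 2$, all integers $t\ge K\log n$ and every initial state $S_0=\{i\}$, \[ \Pr\big[\,|S_t|\le f n\,\big]\ \le\ C\,\frac{\log^3 n}{n}. \] (2) There is a constant $K$ such that for every $m$ and every $\varepsilon>0$ there are $c_0$ and $C$, depending only on $m$ and $\varepsilon$, such that for all $n\ge 2$, all $c_0\le c\le n$, all integers $t\ge K\log n$ (so that depth $O(\log n)$ suffices) and every set $Q$ of $m$ of the $n$ qubits: with probability at least $1-C\,\frac{\log^3 n}{n}$ over the parallel random circuit of depth $t$, \[ \binom{n}{c}^{-1}\sum_{T\subseteq\{1,\dots,n\},\ |T|=n-c}\ \Big\|\rho_{MT}-\frac{\mathbb 1}{2^m}\otimes\frac{\mathbb 1}{2^{|T|}}\Big\|_1\ \le\ \varepsilon . \] -/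

import Mathlib

open MeasureTheory ProbabilityTheory
open scoped Kronecker BigOperators

noncomputable section

namespace Scrambling

/-! ### Random two-qubit gates -/

/-- The unitary group of two qubits. -/
abbrev Gate : Type := Matrix.unitaryGroup (Fin 2 × Fin 2) ℂ

instance : MeasurableSpace Gate := borel Gate

instance : BorelSpace Gate := ⟨rfl⟩

instance : CompactSpace Gate := by
  have hc : IsClosed (Matrix.unitaryGroup (Fin 2 × Fin 2) ℂ : Set (Matrix (Fin 2 × Fin 2) (Fin 2 × Fin 2) ℂ)) :=
    isClosed_unitary
  refine isCompact_iff_compactSpace.mp ?_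
  have hK : IsCompact (Set.pi Set.univ fun _ : Fin 2 × Fin 2 =>
      Set.pi Set.univ fun _ : Fin 2 × Fin 2 => Metric.closedBall (0 : ℂ) 1) :=
    isCompact_univ_pi fun _ => isCompact_univ_pi fun _ => isCompact_closedBall 0 1
  refine hK.of_isClosed_subset hc ?_
  intro U hU i _ j _
  simpa using entry_norm_bound_of_unitary hU i j

/-- The Pauli matrices `σ₀ = 1, σ₁, σ₂, σ₃`. -/
def pauli : Fin 4 → Matrix (Fin 2) (Fin 2) ℂ
  | 0 => 1
  | 1 => !![0, 1; 1, 0]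
  | 2 => !![0, -Complex.I; Complex.I, 0]
  | 3 => !![1, 0; 0, -1]

/-- The two-qubit Pauli group `{iᵏ σ_a ⊗ σ_b}`, as a set of unitaries. -/
def pauliGroup : Set Gate :=
  {P | ∃ k a b : Fin 4, (P : Matrix (Fin 2 × Fin 2) (Fin 2 × Fin 2) ℂ)
    = Complex.I ^ (k : ℕ) • (pauli a ⊗ₖ pauli b)}

/-- The two-qubit Clifford group: the normalizer of the Pauli group in the unitary group. It
contains all global phases. -/
def cliffordGroup : Subgroup Gate := Subgroup.normalizer pauliGroup

theorem finite_pauliGroup : pauliGroup.Finite := by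
  have : Set.Finite (Set.range fun q : Fin 4 × Fin 4 × Fin 4 =>
      Complex.I ^ (q.1 : ℕ) • (pauli q.2.1 ⊗ₖ pauli q.2.2)) := Set.finite_range _
  refine (this.preimage (f := fun P : Gate =>
    (P : Matrix (Fin 2 × Fin 2) (Fin 2 × Fin 2) ℂ)) Subtype.val_injective.injOn).subset ?_
  rintro P ⟨k, a, b, h⟩
  exact ⟨(k, a, b), h.symm⟩

theorem isClosed_cliffordGroup : IsClosed (cliffordGroup : Set Gate) := by
  have hP : IsClosed pauliGroup := finite_pauliGroup.isClosed
  have h : (cliffordGroup : Set Gate) = ⋂ P ∈ pauliGroup,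
      ((fun g : Gate => g * P * g⁻¹) ⁻¹' pauliGroup ∩ (fun g : Gate => g⁻¹ * P * g) ⁻¹' pauliGroup) := by
    ext g
    simp only [cliffordGroup, SetLike.mem_coe, Set.mem_iInter,
      Set.mem_inter_iff, Set.mem_preimage]
    constructor
    · intro hg P hPm
      refine ⟨(hg P).1 hPm, (hg _).2 ?_⟩
      simpa [mul_assoc] using hPm
    · intro hg P
      refine ⟨fun hPm => (hg P hPm).1, fun hPm => ?_⟩
      simpa [mul_assoc] using (hg _ hPm).2
  rw [h]
  refine isClosed_biInter fun P _ => (hP.preimage ?_).inter (hP.preimage ?_)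
  · fun_prop
  · fun_prop

/-- The two choices of random two-qubit gate: Haar random or random Clifford. -/
inductive GateModel : Type
  | haar
  | clifford

/-- The compact group from which the two-qubit gates are drawn. -/
def GateModel.group : GateModel → Subgroup Gate
  | .haar => ⊤
  | .clifford => cliffordGroup

instance (𝒢 : GateModel) : CompactSpace 𝒢.group := by
  refine isCompact_iff_compactSpace.mp (IsClosed.isCompact ?_)
  cases 𝒢
  · exact isClosed_univ
  · exact isClosed_cliffordGroup

/-- The law of one random gate: the normalized Haar measure of the group of gates, seen as a
measure on two-qubit unitaries. For the Clifford group, which modulo global phases is finite, this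
is the uniformly random Clifford gate (with an irrelevant uniformly random phase). -/
def GateModel.law (𝒢 : GateModel) : Measure Gate :=
  (Measure.haarMeasure (⊤ : TopologicalSpace.PositiveCompacts 𝒢.group)).map Subtype.val

instance (𝒢 : GateModel) : IsProbabilityMeasure 𝒢.law := by
  have : IsProbabilityMeasure
      (Measure.haarMeasure (⊤ : TopologicalSpace.PositiveCompacts 𝒢.group)) :=
    ⟨by simpa using Measure.haarMeasure_self (K₀ := (⊤ : TopologicalSpace.PositiveCompacts 𝒢.group))⟩
  exact Measure.isProbabilityMeasure_map measurable_subtype_coe.aemeasurable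

/-! ### Random maximum matchings and parallel random circuits -/

/-- A maximum matching of the complete graph on `n` vertices, encoded by the involution that sends
each vertex to its partner and fixes an unmatched vertex. It is maximum if and only if at most one
vertex is unmatched. -/
def Matching (n : ℕ) : Type :=
  {σ : Equiv.Perm (Fin n) // (∀ i, σ (σ i) = i) ∧ ∀ i j, σ i = i → σ j = j → i = j}

instance (n : ℕ) : Fintype (Matching n) := by
  classical exact inferInstanceAs (Fintype
    {σ : Equiv.Perm (Fin n) // (∀ i, σ (σ i) = i) ∧ ∀ i j, σ i = i → σ j = j → i = j})

instance (n : ℕ) : MeasurableSpace (Matching n) := ⊤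

instance (n : ℕ) : MeasurableSingletonClass (Matching n) := ⟨fun _ => trivial⟩

instance (n : ℕ) : Nonempty (Matching n) := by
  refine ⟨⟨Fin.revPerm, fun i => by simp, fun i j hi hj => ?_⟩⟩
  simp only [Fin.revPerm_apply, Fin.ext_iff, Fin.val_rev] at hi hj
  ext
  omega

/-- One layer of a circuit on `n` qubits: a maximum matching and, for each matched pair
`i < σ i`, the two-qubit gate with label `i` acting on qubits `i` and `σ i`. (Gates with other
labels are not used.) -/
abbrev Layer (n : ℕ) : Type := Matching n × (Fin n → Gate)

/-- The law of a random layer: a uniformly random maximum matching and independent random gates. -/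
def layerLaw (𝒢 : GateModel) (n : ℕ) : Measure (Layer n) :=
  (uniformOn (Set.univ : Set (Matching n))).prod (Measure.pi fun _ => 𝒢.law)

instance (𝒢 : GateModel) (n : ℕ) : IsProbabilityMeasure (layerLaw 𝒢 n) := by
  have : IsProbabilityMeasure (uniformOn (Set.univ : Set (Matching n))) :=
    isProbabilityMeasure_uniformOn Set.finite_univ Set.univ_nonempty
  unfold layerLaw
  infer_instance

/-- The law of a parallel random circuit of depth `t` on `n` qubits: `t` independent layers. -/
def circuitLaw (𝒢 : GateModel) (n t : ℕ) : Measure (Fin t → Layer n) :=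
  Measure.pi fun _ => layerLaw 𝒢 n

instance (𝒢 : GateModel) (n t : ℕ) : IsProbabilityMeasure (circuitLaw 𝒢 n t) := by
  unfold circuitLaw
  infer_instance

/-- The computational basis of the qubits labelled by `V`: bit strings indexed by `V`. -/
abbrev Bits (V : Type) : Type := V → Fin 2

/-- The operator of one layer on `n` qubits: the tensor product of the gates on the matched pairs
and of the identity on the unmatched qubit (if there is one), given by its matrix entries. -/
def layerMatrix {n : ℕ} (L : Layer n) : Matrix (Bits (Fin n)) (Bits (Fin n)) ℂ := fun x y =>
  (∏ i with i < L.1.1 i,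
    (L.2 i : Matrix (Fin 2 × Fin 2) (Fin 2 × Fin 2) ℂ) (x i, x (L.1.1 i)) (y i, y (L.1.1 i))) *
  ∏ i with L.1.1 i = i, if x i = y i then 1 else 0

/-- The operator of a circuit: layer `0` acts first, and the last layer acts last. -/
def circuitMatrix {n : ℕ} : {t : ℕ} → (Fin t → Layer n) → Matrix (Bits (Fin n)) (Bits (Fin n)) ℂ
  | 0, _ => 1
  | t + 1, w => layerMatrix (w (Fin.last t)) * circuitMatrix (fun s : Fin t => w s.castSucc)

/-! ### The entanglement assisted setting -/

/-- The amplitudes of the maximally entangled state `2^{-|V|/2} ∑ₓ |x⟩|x⟩` of two copies of the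
qubits `V`. -/
def maxEntangled {V : Type} [Fintype V] (x y : Bits V) : ℂ :=
  if x = y then ((Real.sqrt (2 ^ Fintype.card V) : ℝ) : ℂ)⁻¹ else 0

/-- The pure initial state of the reference `M`, the assistance `A` and the `n` qubits of the
circuit: the message qubits `Q` are maximally entangled with `M`, and the other qubits are maximally
entangled with `A`. -/
def initialState {n : ℕ} (Q : Finset (Fin n)) :
    (Bits Q × Bits (Qᶜ : Finset (Fin n))) × Bits (Fin n) → ℂ := fun p =>
  maxEntangled p.1.1 (fun i => p.2 i) * maxEntangled p.1.2 (fun i => p.2 i)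

/-- The pure output state: the operator `U` is applied to the `n` qubits of the circuit, and the
identity to `M` and `A`. -/
def outputState {n : ℕ} (Q : Finset (Fin n)) (U : Matrix (Bits (Fin n)) (Bits (Fin n)) ℂ) :
    (Bits Q × Bits (Qᶜ : Finset (Fin n))) × Bits (Fin n) → ℂ := fun p =>
  ∑ b, U p.2 b * initialState Q (p.1, b)

/-- The bit string that is `s` on `T` and `r` outside `T`. -/
def glue {n : ℕ} (T : Finset (Fin n)) (s : Bits T) (r : Bits (Tᶜ : Finset (Fin n))) :
    Bits (Fin n) := fun i =>
  if h : i ∈ T then s ⟨i, h⟩ else r ⟨i, Finset.mem_compl.2 h⟩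

/-- The reduced output state `ρ_{MT}` on the reference `M` and the qubits `T` of the output: the
partial trace of the output state over `A` and over the qubits outside `T`. -/
def reducedOutput {n : ℕ} (Q T : Finset (Fin n)) (U : Matrix (Bits (Fin n)) (Bits (Fin n)) ℂ) :
    Matrix (Bits Q × Bits T) (Bits Q × Bits T) ℂ := fun p q =>
  ∑ a : Bits (Qᶜ : Finset (Fin n)), ∑ r : Bits (Tᶜ : Finset (Fin n)),
    outputState Q U ((p.1, a), glue T p.2 r) * star (outputState Q U ((q.1, a), glue T q.2 r))

/-- The maximally mixed state of the qubits labelled by `V`. -/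
def maxMixed (V : Type) [Fintype V] [DecidableEq V] : Matrix (Bits V) (Bits V) ℂ :=
  ((2 : ℂ) ^ Fintype.card V)⁻¹ • 1

/-- The trace norm (Schatten `1`-norm): the sum of the singular values. -/
def traceNorm {ι : Type} [Fintype ι] [DecidableEq ι] (X : Matrix ι ι ℂ) : ℝ :=
  ∑ i, Real.sqrt ((Matrix.isHermitian_conjTranspose_mul_self X).eigenvalues i)

/-- The average, over a uniformly random set `T` of `k` of the `n` output qubits, of the trace
distance `‖ρ_{MT} - 1/2^{|M|} ⊗ 1/2^{|T|}‖₁`. -/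
def averageDistance {n : ℕ} (Q : Finset (Fin n)) (k : ℕ)
    (U : Matrix (Bits (Fin n)) (Bits (Fin n)) ℂ) : ℝ :=
  (∑ T ∈ (Finset.univ : Finset (Fin n)).powersetCard k,
    traceNorm (reducedOutput Q T U - maxMixed Q ⊗ₖ maxMixed T)) / (n.choose k : ℝ)

/-! ### The support chain -/

/-- The probability that a matched pair in which some vertex is in the current set (`active`), or
in which no vertex is, has its two vertices in the next set exactly as prescribed by `a` and `b`:
an inactive pair stays out of the set; from an active pair both vertices are in the next set with
probability `9/15`, and only the first, or only the second, with probability `3/15` each. -/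
def pairProb (active a b : Prop) [Decidable active] [Decidable a] [Decidable b] : ℝ :=
  if active then (if a ∧ b then 9 / 15 else if a ∨ b then 3 / 15 else 0)
  else if a ∨ b then 0 else 1

/-- The transition matrix of the support chain on the subsets of the `n` qubits: a uniformly random
maximum matching is drawn, the matched pairs are updated independently, and the unmatched vertex (if
there is one) stays as it is. -/
def supportChain (n : ℕ) : Matrix (Finset (Fin n)) (Finset (Fin n)) ℝ := fun S S' =>
  (∑ σ : Matching n,
    (∏ i with i < σ.1 i, pairProb (i ∈ S ∨ σ.1 i ∈ S) (i ∈ S') (σ.1 i ∈ S')) *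
    ∏ i with σ.1 i = i, if (i ∈ S ↔ i ∈ S') then (1 : ℝ) else 0) / Fintype.card (Matching n)

/-- The probability that the support chain started in `S` has size at most `r` after `t` steps. -/
def probSupportLE {n : ℕ} (S : Finset (Fin n)) (t : ℕ) (r : ℝ) : ℝ :=
  ∑ S' with (S'.card : ℝ) ≤ r, (supportChain n ^ t) S S'

end Scrambling

end

noncomputable section

namespace Scrambling

/-! ### Sums and products over the pairs of a matching -/

section Pairs

variable {n : ℕ}

/-- A product over all vertices, grouped by the pairs of a matching. -/
@[to_additive]
theorem prod_matching {R : Type*} [CommMonoid R] (σ : Matching n) (u : Fin n → R) :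
    ∏ i, u i = (∏ i with i < σ.1 i, u i * u (σ.1 i)) * ∏ i with σ.1 i = i, u i := by
  classical
  have h1 : ∏ i with σ.1 i < i, u i = ∏ i with i < σ.1 i, u (σ.1 i) := by
    refine Finset.prod_bij' (fun i _ => σ.1 i) (fun i _ => σ.1 i) ?_ ?_ ?_ ?_ ?_ <;>
      simp [σ.2.1]
  rw [Finset.prod_mul_distrib, ← h1,
    ← Finset.prod_filter_mul_prod_filter_not Finset.univ (fun i => i < σ.1 i) u, mul_assoc,
    ← Finset.prod_filter_mul_prod_filter_not (Finset.univ.filter fun i => ¬ i < σ.1 i)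
      (fun i => σ.1 i < i) u, Finset.filter_filter, Finset.filter_filter]
  congr 2
  · congr 1
    ext i
    simp only [Finset.mem_filter, Finset.mem_univ, true_and]
    constructor
    · exact fun h => h.2
    · exact fun h => ⟨h.not_gt, h⟩
  · congr 1
    ext i
    simp only [Finset.mem_filter, Finset.mem_univ, true_and, not_lt]
    constructor
    · exact fun h => le_antisymm h.1 h.2
    · exact fun h => ⟨h.le, h.ge⟩

/-- Labellings of the vertices are labellings of the pairs and of the fixed points. -/
def matchingEquiv (κ : Type*) (σ : Matching n) :
    (Fin n → κ) ≃ ({i // i < σ.1 i} → κ × κ) × ({i // σ.1 i = i} → κ) where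
  toFun y := (fun i => (y i, y (σ.1 i)), fun i => y i)
  invFun p j :=
    if h : j < σ.1 j then (p.1 ⟨j, h⟩).1
    else if h' : σ.1 j < j then (p.1 ⟨σ.1 j, by rwa [σ.2.1]⟩).2
    else p.2 ⟨j, le_antisymm (not_lt.1 h) (not_lt.1 h')⟩
  left_inv y := by
    funext j
    dsimp only
    split_ifs <;> simp [σ.2.1]
  right_inv p := by
    refine Prod.ext ?_ ?_
    · funext i
      obtain ⟨i, hi⟩ := i
      simp [hi, σ.2.1, hi.not_gt]
    · funext i
      obtain ⟨i, hi⟩ := i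
      simp [hi]

/-- A sum over labellings of a product over the pairs and the fixed points of a matching
factorizes. -/
theorem sum_prod_matching {κ R : Type*} [Fintype κ] [CommSemiring R] (σ : Matching n)
    (g : Fin n → κ → κ → R) (h : Fin n → κ → R) :
    ∑ y : Fin n → κ, (∏ i with i < σ.1 i, g i (y i) (y (σ.1 i))) * ∏ i with σ.1 i = i, h i (y i)
      = (∏ i with i < σ.1 i, ∑ a, ∑ b, g i a b) * ∏ i with σ.1 i = i, ∑ a, h i a := by
  classical
  have hp : ∀ (p : Fin n → Prop) [DecidablePred p] (f : Fin n → R),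
      ∏ i with p i, f i = ∏ i : {i // p i}, f i := fun p _ f =>
    Finset.prod_subtype _ (by simp) f
  simp only [hp]
  rw [← (matchingEquiv κ σ).symm.sum_comp, Fintype.sum_prod_type]
  have e : ∀ p : ({i // i < σ.1 i} → κ × κ) × ({i // σ.1 i = i} → κ),
      (∏ i : {i // i < σ.1 i}, g i ((matchingEquiv κ σ).symm p i)
        ((matchingEquiv κ σ).symm p (σ.1 i))) *
        ∏ i : {i // σ.1 i = i}, h i ((matchingEquiv κ σ).symm p i)
      = (∏ i : {i // i < σ.1 i}, g i (p.1 i).1 (p.1 i).2) *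
          ∏ i : {i // σ.1 i = i}, h i (p.2 i) := by
    intro p
    obtain ⟨y, rfl⟩ := (matchingEquiv κ σ).surjective p
    rw [Equiv.symm_apply_apply]
    rfl
  simp only [e]
  rw [← Finset.sum_mul_sum]
  congr 1
  · simp only [← Fintype.sum_prod_type']
    rw [Fintype.prod_sum]
  · rw [Fintype.prod_sum]

end Pairs

/-! ### Uniformly random matchings -/

section RandomMatching

variable {n : ℕ}

/-- The expectation over a uniformly random maximum matching. -/
def matchingAvg (F : Matching n → ℝ) : ℝ := (∑ σ, F σ) / Fintype.card (Matching n)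

theorem card_matching_pos : (0 : ℝ) < Fintype.card (Matching n) := by
  exact_mod_cast Fintype.card_pos

theorem matchingAvg_mono {F G : Matching n → ℝ} (h : ∀ σ, F σ ≤ G σ) :
    matchingAvg F ≤ matchingAvg G :=
  div_le_div_of_nonneg_right (Finset.sum_le_sum fun σ _ => h σ) card_matching_pos.le

theorem matchingAvg_const (c : ℝ) : matchingAvg (fun _ : Matching n => c) = c := by
  have := card_matching_pos (n := n)
  simp only [matchingAvg, Finset.sum_const, Finset.card_univ, nsmul_eq_mul]
  field_simp

theorem matchingAvg_add (F G : Matching n → ℝ) :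
    matchingAvg (fun σ => F σ + G σ) = matchingAvg F + matchingAvg G := by
  simp [matchingAvg, Finset.sum_add_distrib, add_div]

theorem matchingAvg_sub (F G : Matching n → ℝ) :
    matchingAvg (fun σ => F σ - G σ) = matchingAvg F - matchingAvg G := by
  simp [matchingAvg, Finset.sum_sub_distrib, sub_div]

theorem matchingAvg_const_mul (c : ℝ) (F : Matching n → ℝ) :
    matchingAvg (fun σ => c * F σ) = c * matchingAvg F := by
  simp only [matchingAvg]
  rw [← Finset.mul_sum, mul_div_assoc]

theorem matchingAvg_sum {ι : Type*} (s : Finset ι) (F : ι → Matching n → ℝ) :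
    matchingAvg (fun σ => ∑ i ∈ s, F i σ) = ∑ i ∈ s, matchingAvg (F i) := by
  simp only [matchingAvg]
  rw [Finset.sum_comm, Finset.sum_div]

theorem matchingAvg_nonneg {F : Matching n → ℝ} (h : ∀ σ, 0 ≤ F σ) : 0 ≤ matchingAvg F :=
  div_nonneg (Finset.sum_nonneg fun σ _ => h σ) card_matching_pos.le

/-- Relabelling the vertices of a matching. -/
def relabel (τ : Equiv.Perm (Fin n)) : Matching n ≃ Matching n where
  toFun σ := ⟨τ⁻¹.trans (σ.1.trans τ), fun i => by simp [σ.2.1], fun i j hi hj => by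
    have hi' : σ.1 (τ⁻¹ i) = τ⁻¹ i := by
      rw [Equiv.Perm.eq_inv_iff_eq]; exact hi
    have hj' : σ.1 (τ⁻¹ j) = τ⁻¹ j := by
      rw [Equiv.Perm.eq_inv_iff_eq]; exact hj
    exact τ⁻¹.injective (σ.2.2 _ _ hi' hj')⟩
  invFun σ := ⟨τ.trans (σ.1.trans τ⁻¹), fun i => by simp [σ.2.1], fun i j hi hj => by
    have hi' : σ.1 (τ i) = τ i := by
      rw [← Equiv.Perm.inv_eq_iff_eq]; exact hi
    have hj' : σ.1 (τ j) = τ j := by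
      rw [← Equiv.Perm.inv_eq_iff_eq]; exact hj
    exact τ.injective (σ.2.2 _ _ hi' hj')⟩
  left_inv σ := by
    apply Subtype.ext
    ext i
    simp
  right_inv σ := by
    apply Subtype.ext
    ext i
    simp

theorem relabel_apply (τ : Equiv.Perm (Fin n)) (σ : Matching n) (x : Fin n) :
    (relabel τ σ).1 (τ x) = τ (σ.1 x) := by
  change τ (σ.1 (τ⁻¹ (τ x))) = _
  simp

theorem matchingAvg_relabel (τ : Equiv.Perm (Fin n)) (F : Matching n → ℝ) :
    matchingAvg (fun σ => F (relabel τ σ)) = matchingAvg F := by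
  simp only [matchingAvg]
  rw [(relabel τ).sum_comp F]

theorem avg_fixed_eq (i j : Fin n) :
    matchingAvg (fun σ => if σ.1 i = i then 1 else 0)
      = matchingAvg (fun σ => if σ.1 j = j then 1 else 0) := by
  rw [← matchingAvg_relabel (Equiv.swap i j) (fun σ => if σ.1 j = j then 1 else 0)]
  congr 1
  funext σ
  have h := relabel_apply (Equiv.swap i j) σ i
  rw [Equiv.swap_apply_left] at h
  simp [h, Equiv.swap_apply_eq_iff]

theorem avg_fixed_le (i : Fin n) :
    matchingAvg (fun σ => if σ.1 i = i then 1 else 0) ≤ 1 / n := by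
  have hn : (0 : ℝ) < n := by exact_mod_cast i.pos
  have h1 : ∑ j : Fin n, matchingAvg (fun σ => if σ.1 j = j then 1 else 0) ≤ 1 := by
    rw [← matchingAvg_sum]
    refine (matchingAvg_mono fun σ => ?_).trans_eq (matchingAvg_const 1)
    rw [Finset.sum_boole]
    have : ((Finset.univ.filter fun j => σ.1 j = j).card) ≤ 1 :=
      Finset.card_le_one.2 fun a ha b hb => σ.2.2 a b (by simpa using ha) (by simpa using hb)
    exact_mod_cast this
  rw [Finset.sum_congr rfl fun j _ => avg_fixed_eq j i] at h1
  simp only [Finset.sum_const, Finset.card_univ, Fintype.card_fin, nsmul_eq_mul] at h1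
  rw [le_div_iff₀ hn]
  linarith

theorem avg_pair_eq {i j j' : Fin n} (h : j ≠ i) (h' : j' ≠ i) :
    matchingAvg (fun σ => if σ.1 i = j then 1 else 0)
      = matchingAvg (fun σ => if σ.1 i = j' then 1 else 0) := by
  rw [← matchingAvg_relabel (Equiv.swap j j') (fun σ => if σ.1 i = j' then 1 else 0)]
  congr 1
  funext σ
  have e := relabel_apply (Equiv.swap j j') σ i
  rw [Equiv.swap_apply_of_ne_of_ne h.symm h'.symm] at e
  simp [e, Equiv.swap_apply_eq_iff]

theorem avg_pair {i j : Fin n} (h : j ≠ i) :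
    (n - 1 : ℝ) * matchingAvg (fun σ => if σ.1 i = j then 1 else 0)
      = 1 - matchingAvg (fun σ => if σ.1 i = i then 1 else 0) := by
  have h1 : ∑ l : Fin n, matchingAvg (fun σ => if σ.1 i = l then 1 else 0) = 1 := by
    rw [← matchingAvg_sum]
    simp [matchingAvg_const]
  rw [← Finset.add_sum_erase _ _ (Finset.mem_univ i),
    Finset.sum_congr rfl fun l hl => avg_pair_eq (Finset.ne_of_mem_erase hl) h] at h1
  have hn : 1 ≤ n := i.pos
  simp only [Finset.sum_const, Finset.card_erase_of_mem (Finset.mem_univ i), Finset.card_univ,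
    Fintype.card_fin, nsmul_eq_mul, Nat.cast_sub hn, Nat.cast_one] at h1
  linarith

theorem avg_pair_le {i j : Fin n} (h : j ≠ i) :
    matchingAvg (fun σ => if σ.1 i = j then 1 else 0) ≤ 1 / (n - 1) := by
  have hn : 1 < n := by
    have := i.2; have := j.2; have : (i : ℕ) ≠ j := fun e => h (Fin.ext e.symm)
    omega
  have hn' : (1 : ℝ) < n := by exact_mod_cast hn
  rw [le_div_iff₀ (by linarith), mul_comm, avg_pair h]
  have := matchingAvg_nonneg (n := n) (F := fun σ => if σ.1 i = i then 1 else 0)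
    (fun σ => by positivity)
  linarith

theorem le_avg_pair {i j : Fin n} (h : j ≠ i) :
    1 / n ≤ matchingAvg (fun σ => if σ.1 i = j then 1 else 0) := by
  have hn : 1 < n := by
    have := i.2; have := j.2; have : (i : ℕ) ≠ j := fun e => h (Fin.ext e.symm)
    omega
  have hn' : (1 : ℝ) < n := by exact_mod_cast hn
  have h1 := avg_pair h
  have h2 := avg_fixed_le i
  have h3 : (n - 1 : ℝ) * (1 / n) = 1 - 1 / n := by field_simp
  exact le_of_mul_le_mul_left (by linarith : (n - 1 : ℝ) * (1 / n) ≤ _) (by linarith)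

theorem avg_two_pairs_eq {i j k l l' : Fin n}
    (hl : l ≠ i ∧ l ≠ j ∧ l ≠ k) (hl' : l' ≠ i ∧ l' ≠ j ∧ l' ≠ k) :
    matchingAvg (fun σ => if σ.1 i = j ∧ σ.1 k = l then 1 else 0)
      = matchingAvg (fun σ => if σ.1 i = j ∧ σ.1 k = l' then 1 else 0) := by
  rw [← matchingAvg_relabel (Equiv.swap l l') (fun σ => if σ.1 i = j ∧ σ.1 k = l' then 1 else 0)]
  congr 1
  funext σ
  have e := relabel_apply (Equiv.swap l l') σ i
  have e' := relabel_apply (Equiv.swap l l') σ k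
  rw [Equiv.swap_apply_of_ne_of_ne hl.1.symm hl'.1.symm] at e
  rw [Equiv.swap_apply_of_ne_of_ne hl.2.2.symm hl'.2.2.symm] at e'
  simp [e, e', Equiv.swap_apply_eq_iff, Equiv.swap_apply_of_ne_of_ne hl.2.1.symm hl'.2.1.symm]

theorem avg_two_pairs_le {i j k l : Fin n} (hij : j ≠ i) (hk : k ≠ i) (hk' : k ≠ j)
    (hl : l ≠ i ∧ l ≠ j ∧ l ≠ k) :
    (n - 3 : ℝ) * matchingAvg (fun σ => if σ.1 i = j ∧ σ.1 k = l then 1 else 0)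
      ≤ matchingAvg (fun σ => if σ.1 i = j then 1 else 0) := by
  set A : Finset (Fin n) := {i, j, k}
  have hA : A.card = 3 := Finset.card_eq_three.2 ⟨i, j, k, hij.symm, hk.symm, hk'.symm, rfl⟩
  have h1 : ∑ l' ∈ Aᶜ, matchingAvg (fun σ => if σ.1 i = j ∧ σ.1 k = l' then 1 else 0)
      ≤ matchingAvg (fun σ => if σ.1 i = j then 1 else 0) := by
    rw [← matchingAvg_sum]
    refine matchingAvg_mono fun σ => ?_
    by_cases h : σ.1 i = j
    · simp only [h, true_and, if_true]
      rw [Finset.sum_ite_eq]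
      split_ifs <;> norm_num
    · simp [h]
  have hmem : ∀ l' ∈ Aᶜ, l' ≠ i ∧ l' ≠ j ∧ l' ≠ k := by
    intro l' h
    simpa [A] using h
  rw [Finset.sum_congr rfl fun l' h' => avg_two_pairs_eq (hmem l' h') hl] at h1
  have h3 : 3 ≤ n := by
    have := Finset.card_le_univ A
    rwa [hA, Fintype.card_fin] at this
  simpa [Finset.card_compl, hA, Nat.cast_sub h3] using h1

/-- Twice the number of pairs of the matching that lie in `S`. -/
def internal (S : Finset (Fin n)) (σ : Matching n) : ℝ :=
  ∑ i ∈ S, ∑ j ∈ S.erase i, if σ.1 i = j then 1 else 0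

theorem internal_nonneg (S : Finset (Fin n)) (σ : Matching n) : 0 ≤ internal S σ :=
  Finset.sum_nonneg fun _ _ => Finset.sum_nonneg fun _ _ => by positivity

theorem avg_internal (S : Finset (Fin n)) : matchingAvg (internal S)
    = ∑ i ∈ S, ∑ j ∈ S.erase i, matchingAvg (fun σ => if σ.1 i = j then 1 else 0) := by
  have : internal S = fun σ => ∑ i ∈ S, ∑ j ∈ S.erase i, if σ.1 i = j then 1 else 0 := rfl
  rw [this, matchingAvg_sum]
  simp only [matchingAvg_sum]

theorem sum_sum_erase_const (S : Finset (Fin n)) (c : ℝ) :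
    ∑ i ∈ S, ∑ _j ∈ S.erase i, c = S.card * (S.card - 1) * c := by
  have : ∀ i ∈ S, ∑ _j ∈ S.erase i, c = (S.card - 1) * c := by
    intro i hi
    have h1 : 1 ≤ S.card := Finset.card_pos.2 ⟨i, hi⟩
    simp [Finset.card_erase_of_mem hi, Nat.cast_sub h1]
  rw [Finset.sum_congr rfl this, Finset.sum_const, nsmul_eq_mul, mul_assoc]

theorem avg_internal_le (S : Finset (Fin n)) :
    matchingAvg (internal S) ≤ S.card * (S.card - 1) / (n - 1) := by
  rw [avg_internal, div_eq_mul_one_div, ← sum_sum_erase_const]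
  exact Finset.sum_le_sum fun i _ => Finset.sum_le_sum fun j hj =>
    avg_pair_le (Finset.ne_of_mem_erase hj)

theorem le_avg_internal (S : Finset (Fin n)) :
    S.card * (S.card - 1) / n ≤ matchingAvg (internal S) := by
  rw [avg_internal, div_eq_mul_one_div, ← sum_sum_erase_const]
  exact Finset.sum_le_sum fun i _ => Finset.sum_le_sum fun j hj =>
    le_avg_pair (Finset.ne_of_mem_erase hj)

theorem pair_mul_internal_le (S : Finset (Fin n)) {i j : Fin n} (hi : i ∈ S) (hj : j ∈ S)
    (hij : j ≠ i) (σ : Matching n) :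
    (if σ.1 i = j then 1 else 0) * internal S σ ≤ 2 * (if σ.1 i = j then 1 else 0) +
      ∑ k ∈ (S.erase i).erase j, ∑ l ∈ ((S.erase i).erase j).erase k,
        if σ.1 i = j ∧ σ.1 k = l then 1 else 0 := by
  by_cases h : σ.1 i = j
  swap
  · simp [h]
  have h' : σ.1 j = i := by rw [← h, σ.2.1]
  have row : ∀ k ∈ S, ∑ l ∈ S.erase k, (if σ.1 k = l then (1 : ℝ) else 0) ≤ 1 := by
    intro k _
    rw [Finset.sum_ite_eq]
    split_ifs <;> norm_num
  have hj' : j ∈ S.erase i := Finset.mem_erase.2 ⟨hij, hj⟩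
  simp only [h, if_true, one_mul, true_and, mul_one]
  rw [internal, ← Finset.add_sum_erase _ _ hi,
    ← Finset.add_sum_erase (S.erase i) (fun k => ∑ l ∈ S.erase k, if σ.1 k = l then (1 : ℝ) else 0)
      hj', ← add_assoc]
  refine add_le_add (by linarith [row i hi, row j hj]) (Finset.sum_le_sum fun k hk => ?_)
  simp only [Finset.mem_erase] at hk
  rw [Finset.sum_ite_eq, Finset.sum_ite_eq]
  have h1 : σ.1 k ≠ i := fun e => hk.1 (by rw [← h, ← e, σ.2.1])
  have h2 : σ.1 k ≠ j := fun e => hk.2.1 (by rw [← h', ← e, σ.2.1])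
  simp [h1, h2]

theorem avg_internal_sq_le (hn : 4 ≤ n) (S : Finset (Fin n)) :
    matchingAvg (fun σ => internal S σ ^ 2)
      ≤ (2 + matchingAvg (internal S)) * matchingAvg (internal S) := by
  have hn' : (4 : ℝ) ≤ n := by exact_mod_cast hn
  have hs : (S.card : ℝ) ≤ n := by
    have := Finset.card_le_univ S
    rw [Fintype.card_fin] at this
    exact_mod_cast this
  have e : ∀ σ, internal S σ ^ 2
      = ∑ i ∈ S, ∑ j ∈ S.erase i, (if σ.1 i = j then 1 else 0) * internal S σ := by
    intro σ
    rw [sq]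
    conv_lhs => enter [1]; rw [internal]
    simp only [Finset.sum_mul]
  simp only [e]
  rw [matchingAvg_sum]
  simp only [matchingAvg_sum]
  conv_rhs => enter [2]; rw [avg_internal]
  simp only [Finset.mul_sum]
  refine Finset.sum_le_sum fun i hi => Finset.sum_le_sum fun j hj => ?_
  have hij := Finset.ne_of_mem_erase hj
  have hjS := Finset.mem_of_mem_erase hj
  refine (matchingAvg_mono (pair_mul_internal_le S hi hjS hij)).trans ?_
  rw [matchingAvg_add, matchingAvg_const_mul, add_mul]
  refine add_le_add le_rfl ?_
  set p := matchingAvg (fun σ => if σ.1 i = j then (1 : ℝ) else 0)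
  have hp : 0 ≤ p := matchingAvg_nonneg fun σ => by positivity
  have hcard : (((S.erase i).erase j).card : ℝ) = S.card - 2 := by
    have h2 : 2 ≤ S.card := by
      have : ({i, j} : Finset (Fin n)) ⊆ S := by
        intro x hx
        simp only [Finset.mem_insert, Finset.mem_singleton] at hx
        rcases hx with rfl | rfl <;> assumption
      calc 2 = ({i, j} : Finset (Fin n)).card := (Finset.card_pair hij.symm).symm
        _ ≤ _ := Finset.card_le_card this
    rw [Finset.card_erase_of_mem hj, Finset.card_erase_of_mem hi, Nat.sub_sub, Nat.cast_sub h2]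
    norm_num
  calc _ = ∑ k ∈ (S.erase i).erase j, ∑ l ∈ ((S.erase i).erase j).erase k,
        matchingAvg (fun σ => if σ.1 i = j ∧ σ.1 k = l then (1 : ℝ) else 0) := by
        rw [matchingAvg_sum]
        simp only [matchingAvg_sum]
    _ ≤ ∑ k ∈ (S.erase i).erase j, ∑ l ∈ ((S.erase i).erase j).erase k, p / (n - 3) := by
        refine Finset.sum_le_sum fun k hk => Finset.sum_le_sum fun l hl => ?_
        simp only [Finset.mem_erase] at hk hl
        rw [le_div_iff₀ (by linarith), mul_comm]
        exact avg_two_pairs_le hij hk.2.1 hk.1 ⟨hl.2.2.1, hl.2.1, hl.1⟩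
    _ = (S.card - 2) * (S.card - 3) / (n - 3) * p := by
        rw [sum_sum_erase_const, hcard]
        ring
    _ ≤ S.card * (S.card - 1) / n * p := by
        refine mul_le_mul_of_nonneg_right ?_ hp
        rw [div_le_div_iff₀ (by linarith) (by linarith)]
        have h2 : (0 : ℝ) ≤ S.card - 2 := by rw [← hcard]; positivity
        have a1 : (n : ℝ) * (S.card - 3) ≤ S.card * (n - 3) := by linarith
        have a2 : (0 : ℝ) ≤ S.card * (n - 3) := mul_nonneg (by linarith) (by linarith)
        calc ((S.card : ℝ) - 2) * (S.card - 3) * n = (S.card - 2) * (n * (S.card - 3)) := by ring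
          _ ≤ (S.card - 2) * (S.card * (n - 3)) := mul_le_mul_of_nonneg_left a1 h2
          _ ≤ (S.card - 1) * (S.card * (n - 3)) :=
            mul_le_mul_of_nonneg_right (by linarith) a2
          _ = _ := by ring
    _ ≤ _ := mul_le_mul_of_nonneg_right (le_avg_internal S) hp

/-- With high probability few pairs of the matching lie in a small set. -/
theorem avg_internal_large_le (hn : 4 ≤ n) (S : Finset (Fin n)) (hS : S.Nonempty)
    (hs : (S.card : ℝ) ≤ (n - 1) / 10) :
    matchingAvg (fun σ => if 6 / 10 * (S.card : ℝ) ≤ internal S σ then 1 else 0)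
      ≤ 1 / S.card := by
  have hn' : (4 : ℝ) ≤ n := by exact_mod_cast hn
  have hs0 : (1 : ℝ) ≤ S.card := by exact_mod_cast hS.card_pos
  set s : ℝ := (S.card : ℝ)
  set e := matchingAvg (internal S)
  have he0 : 0 ≤ e := matchingAvg_nonneg (internal_nonneg S)
  have he : e ≤ s / 10 := by
    refine (avg_internal_le S).trans ?_
    rw [div_le_iff₀ (by linarith)]
    change s * (s - 1) ≤ _
    nlinarith
  have hvar : matchingAvg (fun σ => (internal S σ - e) ^ 2) ≤ 2 * e := by
    have : ∀ σ, (internal S σ - e) ^ 2 = internal S σ ^ 2 - (2 * e * internal S σ - e ^ 2) := by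
      intro σ; ring
    simp only [this]
    rw [matchingAvg_sub, matchingAvg_sub, matchingAvg_const_mul, matchingAvg_const]
    have := avg_internal_sq_le hn S
    change _ ≤ (2 + e) * e at this
    change _ - (2 * e * e - e ^ 2) ≤ _
    nlinarith
  calc _ ≤ matchingAvg (fun σ => 1 / (s / 2) ^ 2 * (internal S σ - e) ^ 2) := by
        refine matchingAvg_mono fun σ => ?_
        split_ifs with h
        · rw [one_div, inv_mul_eq_div, le_div_iff₀ (by positivity), one_mul]
          exact pow_le_pow_left₀ (by linarith) (by linarith) 2
        · positivity
    _ = 1 / (s / 2) ^ 2 * matchingAvg (fun σ => (internal S σ - e) ^ 2) :=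
        matchingAvg_const_mul _ _
    _ ≤ 1 / (s / 2) ^ 2 * (s / 4) :=
        mul_le_mul_of_nonneg_left (by linarith) (by positivity)
    _ = _ := by field_simp; norm_num

end RandomMatching

/-! ### One step of the support chain -/

section Step

variable {n : ℕ}

/-- The transition probability of the support chain for a given matching. -/
def stepProb (σ : Matching n) (S S' : Finset (Fin n)) : ℝ :=
  (∏ i with i < σ.1 i, pairProb (i ∈ S ∨ σ.1 i ∈ S) (i ∈ S') (σ.1 i ∈ S')) *
    ∏ i with σ.1 i = i, if (i ∈ S ↔ i ∈ S') then (1 : ℝ) else 0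

theorem supportChain_eq (S S' : Finset (Fin n)) :
    supportChain n S S' = matchingAvg fun σ => stepProb σ S S' := rfl

theorem pairProb_nonneg (p a b : Prop) [Decidable p] [Decidable a] [Decidable b] :
    0 ≤ pairProb p a b := by
  unfold pairProb
  split_ifs <;> norm_num

theorem stepProb_nonneg (σ : Matching n) (S S' : Finset (Fin n)) : 0 ≤ stepProb σ S S' :=
  mul_nonneg (Finset.prod_nonneg fun _ _ => pairProb_nonneg _ _ _)
    (Finset.prod_nonneg fun _ _ => by positivity)

/-- Subsets as indicator functions. -/
def finsetEquivBool (ι : Type*) [Fintype ι] [DecidableEq ι] : Finset ι ≃ (ι → Bool) where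
  toFun S i := decide (i ∈ S)
  invFun y := Finset.univ.filter fun i => y i = true
  left_inv S := by ext; simp
  right_inv y := by ext; simp

/-- A sum over subsets of a product over the pairs and the fixed points of a matching
factorizes. -/
theorem sum_finset_matching {R : Type*} [CommSemiring R] (σ : Matching n)
    (g : Fin n → Bool → Bool → R) (h : Fin n → Bool → R) :
    ∑ S : Finset (Fin n), (∏ i with i < σ.1 i, g i (decide (i ∈ S)) (decide (σ.1 i ∈ S))) *
        ∏ i with σ.1 i = i, h i (decide (i ∈ S))
      = (∏ i with i < σ.1 i, ∑ a, ∑ b, g i a b) * ∏ i with σ.1 i = i, ∑ a, h i a := by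
  rw [← sum_prod_matching, ← (finsetEquivBool (Fin n)).sum_comp]
  rfl

theorem sum_stepProb_mul_prod (σ : Matching n) (S J : Finset (Fin n)) (hJ : ∀ i ∈ J, i < σ.1 i) :
    ∑ S', stepProb σ S S' * ∏ i ∈ J, (if i ∈ S' ∧ σ.1 i ∈ S' then (1 : ℝ) else 0)
      = ∏ i ∈ J, if i ∈ S ∨ σ.1 i ∈ S then 6 / 10 else 0 := by
  classical
  have hJ' : ∀ f : Fin n → ℝ, ∏ i ∈ J, f i = ∏ i with i < σ.1 i, if i ∈ J then f i else 1 := by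
    intro f
    rw [Finset.prod_ite, Finset.prod_const_one, mul_one]
    refine Finset.prod_congr ?_ fun _ _ => rfl
    ext i
    simpa using hJ i
  have h := sum_finset_matching σ
    (fun i a b => pairProb (i ∈ S ∨ σ.1 i ∈ S) (a = true) (b = true) *
      if i ∈ J then (if a = true ∧ b = true then (1 : ℝ) else 0) else 1)
    (fun i a => if (i ∈ S ↔ a = true) then (1 : ℝ) else 0)
  simp only [decide_eq_true_eq, Finset.prod_mul_distrib] at h
  simp only [hJ', stepProb]
  convert h using 1
  · refine Finset.sum_congr rfl fun S' _ => ?_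
    ring
  · rw [Finset.prod_eq_one (s := Finset.univ.filter fun i => σ.1 i = i), mul_one]
    · refine Finset.prod_congr rfl fun i _ => ?_
      by_cases h1 : i ∈ J <;> by_cases h2 : i ∈ S ∨ σ.1 i ∈ S <;>
        simp [pairProb, h1, h2] <;> norm_num
    · intro i _
      by_cases h1 : i ∈ S <;> simp [h1]

theorem sum_stepProb (σ : Matching n) (S : Finset (Fin n)) : ∑ S', stepProb σ S S' = 1 := by
  simpa using sum_stepProb_mul_prod σ S ∅ (by simp)

/-- The number of pairs of the matching inside a set. -/
def innerPairs (σ : Matching n) (S : Finset (Fin n)) : ℝ :=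
  ∑ i with i < σ.1 i, if i ∈ S ∧ σ.1 i ∈ S then 1 else 0

/-- The number of pairs of the matching that meet a set. -/
def activePairs (σ : Matching n) (S : Finset (Fin n)) : ℝ :=
  ∑ i with i < σ.1 i, if i ∈ S ∨ σ.1 i ∈ S then 1 else 0

/-- The number of unmatched vertices in a set. -/
def unmatched (σ : Matching n) (S : Finset (Fin n)) : ℝ :=
  ∑ i with σ.1 i = i, if i ∈ S then 1 else 0

theorem innerPairs_nonneg (σ : Matching n) (S : Finset (Fin n)) : 0 ≤ innerPairs σ S :=
  Finset.sum_nonneg fun _ _ => by positivity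

theorem unmatched_nonneg (σ : Matching n) (S : Finset (Fin n)) : 0 ≤ unmatched σ S :=
  Finset.sum_nonneg fun _ _ => by positivity

theorem innerPairs_le_activePairs (σ : Matching n) (S : Finset (Fin n)) :
    innerPairs σ S ≤ activePairs σ S :=
  Finset.sum_le_sum fun i _ => by
    by_cases h1 : i ∈ S <;> by_cases h2 : σ.1 i ∈ S <;> simp [h1, h2]

theorem card_eq_sum_matching (σ : Matching n) (S : Finset (Fin n)) :
    (S.card : ℝ) = (∑ i with i < σ.1 i, ((if i ∈ S then (1 : ℝ) else 0)
      + if σ.1 i ∈ S then 1 else 0)) + unmatched σ S := by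
  rw [unmatched, ← sum_matching σ fun i => if i ∈ S then (1 : ℝ) else 0]
  simp

theorem card_eq_active_add (σ : Matching n) (S : Finset (Fin n)) :
    (S.card : ℝ) = activePairs σ S + innerPairs σ S + unmatched σ S := by
  rw [card_eq_sum_matching σ S, activePairs, innerPairs, ← Finset.sum_add_distrib]
  congr 1
  refine Finset.sum_congr rfl fun i _ => ?_
  by_cases h1 : i ∈ S <;> by_cases h2 : σ.1 i ∈ S <;> simp [h1, h2]

theorem internal_eq (σ : Matching n) (S : Finset (Fin n)) : internal S σ = 2 * innerPairs σ S := by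
  have h1 : internal S σ = ∑ i, if i ∈ S ∧ σ.1 i ∈ S ∧ σ.1 i ≠ i then (1 : ℝ) else 0 := by
    rw [internal, ← Finset.sum_filter_add_sum_filter_not Finset.univ (fun i => i ∈ S)
      (fun i => if i ∈ S ∧ σ.1 i ∈ S ∧ σ.1 i ≠ i then (1 : ℝ) else 0)]
    rw [Finset.sum_eq_zero (s := Finset.univ.filter fun i => ¬ i ∈ S), add_zero]
    · symm
      refine Finset.sum_congr (by ext; simp) fun i hi => ?_
      rw [Finset.sum_ite_eq]
      simp [hi, and_comm]
    · intro i hi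
      simp only [Finset.mem_filter, Finset.mem_univ, true_and] at hi
      simp [hi]
  rw [h1, sum_matching σ, innerPairs, Finset.mul_sum,
    Finset.sum_eq_zero (s := Finset.univ.filter fun i => σ.1 i = i), add_zero]
  · refine Finset.sum_congr rfl fun i hi => ?_
    simp only [Finset.mem_filter, Finset.mem_univ, true_and] at hi
    by_cases h1 : i ∈ S <;> by_cases h2 : σ.1 i ∈ S <;> simp [h1, h2, σ.2.1, hi.ne, hi.ne']
    norm_num
  · intro i hi
    simp only [Finset.mem_filter, Finset.mem_univ, true_and] at hi
    simp [hi]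

theorem card_add_innerPairs {σ : Matching n} {S S' : Finset (Fin n)} (h : stepProb σ S S' ≠ 0) :
    (S'.card : ℝ) + innerPairs σ S = S.card + innerPairs σ S' := by
  have h1 := Finset.prod_ne_zero_iff.1 (left_ne_zero_of_mul h)
  have h2 := Finset.prod_ne_zero_iff.1 (right_ne_zero_of_mul h)
  have hu : unmatched σ S' = unmatched σ S := by
    refine Finset.sum_congr rfl fun i hi => ?_
    have := h2 i hi
    by_cases a : i ∈ S <;> by_cases b : i ∈ S' <;> simp_all
  rw [card_eq_sum_matching σ S, card_eq_sum_matching σ S', hu]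
  refine (add_right_comm _ _ _).trans (Eq.trans ?_ (add_right_comm _ _ _))
  rw [innerPairs, innerPairs]
  refine congrArg (· + unmatched σ S) ?_
  refine Finset.sum_add_distrib.symm.trans (Eq.trans ?_ Finset.sum_add_distrib)
  refine Finset.sum_congr rfl fun i hi => ?_
  have := h1 i hi
  unfold pairProb at this
  by_cases a : i ∈ S <;> by_cases b : σ.1 i ∈ S <;> by_cases c : i ∈ S' <;>
    by_cases d : σ.1 i ∈ S' <;> simp [a, b, c, d] at this ⊢

theorem innerPairs_le_of_stepProb {σ : Matching n} {S S' : Finset (Fin n)}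
    (h : stepProb σ S S' ≠ 0) : innerPairs σ S' ≤ activePairs σ S := by
  have h1 := Finset.prod_ne_zero_iff.1 (left_ne_zero_of_mul h)
  refine Finset.sum_le_sum fun i hi => ?_
  have := h1 i hi
  unfold pairProb at this
  by_cases a : i ∈ S <;> by_cases b : σ.1 i ∈ S <;> by_cases c : i ∈ S' <;>
    by_cases d : σ.1 i ∈ S' <;> simp [a, b, c, d] at this ⊢

theorem half_card_le {σ : Matching n} {S S' : Finset (Fin n)} (h : stepProb σ S S' ≠ 0) :
    (S.card : ℝ) / 2 ≤ S'.card := by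
  have h1 := card_add_innerPairs h
  have h2 := card_eq_active_add σ S
  have h3 := innerPairs_le_activePairs σ S
  have h4 := innerPairs_nonneg σ S'
  have h5 := unmatched_nonneg σ S
  linarith

theorem sum_stepProb_mul_innerPairs (σ : Matching n) (S : Finset (Fin n)) :
    ∑ S', stepProb σ S S' * innerPairs σ S' = 6 / 10 * activePairs σ S := by
  simp only [innerPairs, Finset.mul_sum, activePairs]
  rw [Finset.sum_comm]
  refine Finset.sum_congr rfl fun i hi => ?_
  have := sum_stepProb_mul_prod σ S {i} (by simpa using hi)
  simp only [Finset.prod_singleton] at this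
  rw [this]
  split_ifs <;> norm_num

theorem sum_stepProb_mul_innerPairs_sq (σ : Matching n) (S : Finset (Fin n)) :
    ∑ S', stepProb σ S S' * (innerPairs σ S' - 6 / 10 * activePairs σ S) ^ 2
      = 24 / 100 * activePairs σ S := by
  have h1 : ∑ S', stepProb σ S S' * innerPairs σ S' ^ 2
      = 36 / 100 * activePairs σ S ^ 2 + 24 / 100 * activePairs σ S := by
    have e : ∀ S', stepProb σ S S' * innerPairs σ S' ^ 2 = ∑ i with i < σ.1 i, ∑ j with j < σ.1 j,
        stepProb σ S S' * ((if i ∈ S' ∧ σ.1 i ∈ S' then 1 else 0) *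
          (if j ∈ S' ∧ σ.1 j ∈ S' then 1 else 0)) := by
      intro S'
      rw [innerPairs, sq, Finset.sum_mul_sum, Finset.mul_sum]
      simp only [Finset.mul_sum]
    simp only [e]
    rw [Finset.sum_comm]
    have e2 : activePairs σ S ^ 2 = ∑ i with i < σ.1 i, ∑ j with j < σ.1 j,
        ((if i ∈ S ∨ σ.1 i ∈ S then 1 else 0) * (if j ∈ S ∨ σ.1 j ∈ S then 1 else 0)) := by
      rw [activePairs, sq, Finset.sum_mul_sum]
    rw [e2, activePairs, Finset.mul_sum, Finset.mul_sum, ← Finset.sum_add_distrib]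
    refine Finset.sum_congr rfl fun i hi => ?_
    rw [Finset.sum_comm, ← Finset.add_sum_erase _ _ hi, Finset.mul_sum,
      ← Finset.add_sum_erase (Finset.univ.filter fun i => i < σ.1 i)
        (fun j => 36 / 100 * ((if i ∈ S ∨ σ.1 i ∈ S then (1 : ℝ) else 0) *
          (if j ∈ S ∨ σ.1 j ∈ S then 1 else 0))) hi, add_right_comm]
    have hi' : i < σ.1 i := by simpa using hi
    congr 1
    · have := sum_stepProb_mul_prod σ S {i} (by simpa using hi)
      simp only [Finset.prod_singleton] at this
      have e3 : ∀ S' : Finset (Fin n), (if i ∈ S' ∧ σ.1 i ∈ S' then (1 : ℝ) else 0) *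
          (if i ∈ S' ∧ σ.1 i ∈ S' then 1 else 0) = if i ∈ S' ∧ σ.1 i ∈ S' then 1 else 0 := by
        intro S'; split_ifs <;> norm_num
      simp only [e3]
      rw [this]
      split_ifs <;> norm_num
    · refine Finset.sum_congr rfl fun j hj => ?_
      have hji := Finset.ne_of_mem_erase hj
      have hj' : j < σ.1 j := by simpa using Finset.mem_of_mem_erase hj
      have := sum_stepProb_mul_prod σ S {i, j} (by simp [hi', hj'])
      simp only [Finset.prod_pair hji.symm] at this
      rw [this]
      split_ifs <;> norm_num
  have e : ∀ S', stepProb σ S S' * (innerPairs σ S' - 6 / 10 * activePairs σ S) ^ 2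
      = stepProb σ S S' * innerPairs σ S' ^ 2
        - 2 * (6 / 10 * activePairs σ S) * (stepProb σ S S' * innerPairs σ S')
        + (6 / 10 * activePairs σ S) ^ 2 * stepProb σ S S' := by
    intro S'; ring
  simp only [e]
  rw [Finset.sum_add_distrib, Finset.sum_sub_distrib, ← Finset.mul_sum, ← Finset.mul_sum, h1,
    sum_stepProb_mul_innerPairs, sum_stepProb]
  ring

theorem inverse_size_bound {s a k u M : ℝ} (hs0 : 1 ≤ s) (hcard : s = a + k + u) (hk : 0 ≤ k)
    (hle : k ≤ a) (hu : 0 ≤ u) (hM : M = s - k) :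
    1 / M * 1 - 1 / (2 * M ^ 2) * (6 / 10 * a)
      ≤ 7 / 10 / s + (7 / 10 * (2 * k) + 12 / 10 * u) / s ^ 2 := by
  have hMs : s / 2 ≤ M := by linarith
  have hM0 : 0 < M := by linarith
  have ha : a = M - u := by linarith
  have e1 : 1 / M * 1 - 1 / (2 * M ^ 2) * (6 / 10 * a) = 7 / 10 * (1 / M) + 3 / 10 * u * (1 / M ^ 2) := by
    rw [ha]; field_simp; ring
  have e2 : 1 / M ≤ 1 / s + 2 * k / s ^ 2 := by
    have hk' : k = s - M := by linarith
    have e : 1 / s + 2 * k / s ^ 2 - 1 / M = k * (2 * M - s) / (s ^ 2 * M) := by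
      rw [hk']; field_simp; ring
    have : 0 ≤ k * (2 * M - s) / (s ^ 2 * M) :=
      div_nonneg (mul_nonneg hk (by linarith)) (by positivity)
    linarith
  have e3 : 1 / M ^ 2 ≤ 4 / s ^ 2 := by
    rw [div_le_div_iff₀ (by positivity) (by positivity)]
    nlinarith
  rw [e1]
  calc _ ≤ 7 / 10 * (1 / s + 2 * k / s ^ 2) + 3 / 10 * u * (4 / s ^ 2) := by
        refine add_le_add (mul_le_mul_of_nonneg_left e2 (by norm_num))
          (mul_le_mul_of_nonneg_left e3 (by positivity))
    _ = _ := by field_simp; ring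

/-- A bound on the mean inverse size after one step, for a given matching. -/
theorem sum_stepProb_inv_card_le (σ : Matching n) {S : Finset (Fin n)} (hS : S.Nonempty) :
    ∑ S', stepProb σ S S' * (1 / (S'.card : ℝ))
      ≤ 7 / 10 / S.card + (7 / 10 * internal S σ + 12 / 10 * unmatched σ S) / S.card ^ 2 := by
  have hs0 : (1 : ℝ) ≤ S.card := by exact_mod_cast hS.card_pos
  have hcard := card_eq_active_add σ S
  have hle := innerPairs_le_activePairs σ S
  have hu := unmatched_nonneg σ S
  have hk := innerPairs_nonneg σ S
  rw [internal_eq]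
  set s : ℝ := (S.card : ℝ)
  set k := innerPairs σ S
  set a := activePairs σ S
  set u := unmatched σ S
  obtain ⟨M, hM⟩ : ∃ M, M = s - k := ⟨_, rfl⟩
  have hMs : s / 2 ≤ M := by linarith
  have hM0 : 0 < M := by linarith
  have h1 : ∀ S', stepProb σ S S' * (1 / (S'.card : ℝ))
      ≤ 1 / M * stepProb σ S S' - 1 / (2 * M ^ 2) * (stepProb σ S S' * innerPairs σ S') := by
    intro S'
    by_cases h : stepProb σ S S' = 0
    · simp [h]
    have hc : (S'.card : ℝ) = M + innerPairs σ S' := by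
      have := card_add_innerPairs h
      linarith
    have hB := innerPairs_le_of_stepProb h
    have hB0 := innerPairs_nonneg σ S'
    set B := innerPairs σ S'
    have hB' : B ≤ M := by change B ≤ a at hB; linarith
    have : 1 / (M + B) ≤ 1 / M - 1 / (2 * M ^ 2) * B := by
      have e : 1 / M - 1 / (2 * M ^ 2) * B - 1 / (M + B) = B * (M - B) / (2 * M ^ 2 * (M + B)) := by
        field_simp
        ring
      have : 0 ≤ B * (M - B) / (2 * M ^ 2 * (M + B)) :=
        div_nonneg (mul_nonneg hB0 (by linarith)) (by positivity)
      linarith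
    rw [hc]
    calc _ ≤ stepProb σ S S' * (1 / M - 1 / (2 * M ^ 2) * B) :=
          mul_le_mul_of_nonneg_left this (stepProb_nonneg _ _ _)
      _ = _ := by ring
  refine (Finset.sum_le_sum fun S' _ => h1 S').trans ?_
  rw [Finset.sum_sub_distrib, ← Finset.mul_sum, ← Finset.mul_sum, sum_stepProb,
    sum_stepProb_mul_innerPairs]
  change 1 / M * 1 - 1 / (2 * M ^ 2) * (6 / 10 * a) ≤ _
  exact inverse_size_bound hs0 hcard hk hle hu hM

/-- The probability that the size decreases, for a given matching. -/
theorem sum_stepProb_card_lt_le (σ : Matching n) {S : Finset (Fin n)} (hS : S.Nonempty) :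
    ∑ S', stepProb σ S S' * (if S'.card < S.card then 1 else 0)
      ≤ (if 6 / 10 * (S.card : ℝ) ≤ internal S σ then 1 else 0) + 100 / S.card := by
  have hs0 : (1 : ℝ) ≤ S.card := by exact_mod_cast hS.card_pos
  have h1 : ∑ S', stepProb σ S S' * (if S'.card < S.card then (1 : ℝ) else 0) ≤ 1 := by
    refine (Finset.sum_le_sum fun S' _ => ?_).trans_eq (sum_stepProb σ S)
    have := stepProb_nonneg σ S S'
    split_ifs <;> linarith
  by_cases hbig : 6 / 10 * (S.card : ℝ) ≤ internal S σ
  · rw [if_pos hbig]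
    have : 0 ≤ 100 / (S.card : ℝ) := by positivity
    linarith
  rw [if_neg hbig, zero_add]
  by_cases hsmall : (S.card : ℝ) ≤ 100
  · refine h1.trans ?_
    rw [le_div_iff₀ (by linarith)]
    linarith
  have hcard := card_eq_active_add σ S
  have hle := innerPairs_le_activePairs σ S
  have hu := unmatched_nonneg σ S
  have hu1 : unmatched σ S ≤ 1 := by
    have h1 : unmatched σ S ≤ ∑ i with σ.1 i = i, 1 :=
      Finset.sum_le_sum fun i _ => by split_ifs <;> norm_num
    refine h1.trans ?_
    have : ((Finset.univ.filter fun j => σ.1 j = j).card) ≤ 1 :=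
      Finset.card_le_one.2 fun a ha b hb => σ.2.2 a b (by simpa using ha) (by simpa using hb)
    simpa using this
  have hk := innerPairs_nonneg σ S
  rw [internal_eq] at hbig
  set s : ℝ := (S.card : ℝ)
  set k := innerPairs σ S
  set a := activePairs σ S
  set u := unmatched σ S
  push Not at hbig hsmall
  calc _ ≤ ∑ S', 1 / (s / 10) ^ 2 * (stepProb σ S S' * (innerPairs σ S' - 6 / 10 * a) ^ 2) := by
        refine Finset.sum_le_sum fun S' _ => ?_
        by_cases h : stepProb σ S S' = 0
        · simp [h]
        have h0 := stepProb_nonneg σ S S'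
        split_ifs with hlt
        swap
        · rw [mul_zero]
          positivity
        have hlt' : (S'.card : ℝ) < s := Nat.cast_lt.2 hlt
        have hc := card_add_innerPairs h
        change (S'.card : ℝ) + k = s + _ at hc
        have : s / 10 ≤ 6 / 10 * a - innerPairs σ S' := by linarith
        have h2 : (s / 10) ^ 2 ≤ (innerPairs σ S' - 6 / 10 * a) ^ 2 := by
          rw [← neg_sq (innerPairs σ S' - 6 / 10 * a)]
          exact pow_le_pow_left₀ (by linarith) (by linarith) 2
        calc stepProb σ S S' * 1 = 1 / (s / 10) ^ 2 * (stepProb σ S S' * (s / 10) ^ 2) := by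
              field_simp
          _ ≤ _ := by gcongr
    _ = 1 / (s / 10) ^ 2 * (24 / 100 * a) := by
        rw [← Finset.mul_sum, sum_stepProb_mul_innerPairs_sq]
    _ ≤ 1 / (s / 10) ^ 2 * s := by
        refine mul_le_mul_of_nonneg_left (by linarith) (by positivity)
    _ = 100 / s := by field_simp; norm_num

end Step

/-! ### Drift of the support chain -/

section Chain

variable {n : ℕ}

theorem sum_supportChain_mul (S : Finset (Fin n)) (F : Finset (Fin n) → ℝ) :
    ∑ S', supportChain n S S' * F S' = matchingAvg fun σ => ∑ S', stepProb σ S S' * F S' := by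
  rw [matchingAvg_sum]
  refine Finset.sum_congr rfl fun S' _ => ?_
  rw [supportChain_eq, mul_comm, ← matchingAvg_const_mul]
  simp only [mul_comm]

theorem supportChain_nonneg (S S' : Finset (Fin n)) : 0 ≤ supportChain n S S' :=
  matchingAvg_nonneg fun σ => stepProb_nonneg σ S S'

theorem sum_supportChain (S : Finset (Fin n)) : ∑ S', supportChain n S S' = 1 := by
  have := sum_supportChain_mul S fun _ => 1
  simpa [sum_stepProb, matchingAvg_const] using this

theorem half_card_le_of_supportChain {S S' : Finset (Fin n)} (h : supportChain n S S' ≠ 0) :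
    (S.card : ℝ) / 2 ≤ S'.card := by
  by_contra hlt
  refine h ?_
  have : ∀ σ : Matching n, stepProb σ S S' = 0 := fun σ => by
    by_contra h'
    exact hlt (half_card_le h')
  rw [supportChain_eq]
  simp [this, matchingAvg_const]

theorem supportChain_pow_nonneg (t : ℕ) (S S' : Finset (Fin n)) :
    0 ≤ (supportChain n ^ t) S S' := by
  induction t generalizing S with
  | zero => rw [pow_zero, Matrix.one_apply]; positivity
  | succ t ih =>
    rw [pow_succ', Matrix.mul_apply]
    exact Finset.sum_nonneg fun T _ => mul_nonneg (supportChain_nonneg S T) (ih T)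

theorem sum_supportChain_pow (t : ℕ) (S : Finset (Fin n)) :
    ∑ S', (supportChain n ^ t) S S' = 1 := by
  induction t generalizing S with
  | zero => simp [Matrix.one_apply]
  | succ t ih =>
    simp only [pow_succ', Matrix.mul_apply]
    rw [Finset.sum_comm]
    simp only [← Finset.mul_sum, ih, mul_one, sum_supportChain]

theorem avg_unmatched_le (S : Finset (Fin n)) :
    matchingAvg (fun σ => unmatched σ S) ≤ S.card / n := by
  have h : ∀ σ : Matching n, unmatched σ S = ∑ i ∈ S, if σ.1 i = i then (1 : ℝ) else 0 := by
    intro σ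
    rw [unmatched, Finset.sum_ite, Finset.sum_const_zero, add_zero, Finset.sum_ite,
      Finset.sum_const_zero, add_zero]
    exact Finset.sum_congr (by ext; simp [and_comm]) fun _ _ => rfl
  simp only [h]
  rw [matchingAvg_sum]
  refine (Finset.sum_le_sum fun i _ => avg_fixed_le i).trans_eq ?_
  simp [div_eq_mul_inv]

theorem sum_supportChain_inv_card_le (hn : 40 ≤ n) {S : Finset (Fin n)} (hS : S.Nonempty)
    (hs : (S.card : ℝ) ≤ (n - 1) / 10) :
    ∑ S', supportChain n S S' * (1 / (S'.card : ℝ)) ≤ 8 / 10 / S.card := by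
  have hn' : (40 : ℝ) ≤ n := by exact_mod_cast hn
  have hs0 : (1 : ℝ) ≤ S.card := by exact_mod_cast hS.card_pos
  rw [sum_supportChain_mul]
  have h1 : matchingAvg (internal S) ≤ S.card / 10 := by
    refine (avg_internal_le S).trans ?_
    rw [div_le_iff₀ (by linarith)]
    nlinarith
  have h2 : matchingAvg (fun σ => unmatched σ S) ≤ S.card / 40 := by
    refine (avg_unmatched_le S).trans ?_
    gcongr
  calc _ ≤ matchingAvg fun σ => 7 / 10 / (S.card : ℝ) + 1 / (S.card : ℝ) ^ 2 *
        (7 / 10 * internal S σ + 12 / 10 * unmatched σ S) :=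
        matchingAvg_mono fun σ => (sum_stepProb_inv_card_le σ hS).trans_eq (by ring)
    _ = 7 / 10 / (S.card : ℝ) + 1 / (S.card : ℝ) ^ 2 * (7 / 10 * matchingAvg (internal S)
        + 12 / 10 * matchingAvg (fun σ => unmatched σ S)) := by
        rw [matchingAvg_add, matchingAvg_const, matchingAvg_const_mul, matchingAvg_add,
          matchingAvg_const_mul, matchingAvg_const_mul]
    _ ≤ 7 / 10 / (S.card : ℝ) + 1 / (S.card : ℝ) ^ 2 * (7 / 10 * (S.card / 10)
        + 12 / 10 * (S.card / 40)) := by gcongr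
    _ = _ := by field_simp; norm_num

theorem sum_supportChain_card_lt_le (hn : 4 ≤ n) {S : Finset (Fin n)} (hS : S.Nonempty)
    (hs : (S.card : ℝ) ≤ (n - 1) / 10) :
    ∑ S', supportChain n S S' * (if S'.card < S.card then 1 else 0) ≤ 101 / S.card := by
  rw [sum_supportChain_mul]
  refine (matchingAvg_mono fun σ => sum_stepProb_card_lt_le σ hS).trans ?_
  rw [matchingAvg_add, matchingAvg_const]
  have := avg_internal_large_le hn S hS hs
  calc _ ≤ 1 / (S.card : ℝ) + 100 / S.card := by gcongr
    _ = _ := by ring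

/-- The Lyapunov function: the inverse size, with a drop by a factor of order `n` where the size
becomes linear in `n`. -/
def lyapunov (n : ℕ) (S : Finset (Fin n)) : ℝ :=
  (if (S.card : ℝ) ≤ n / 40 then (1 : ℝ) else 80800 / (n : ℝ)) * (1 / max 1 (S.card : ℝ))

theorem lyapunov_drift (hn : 80800 ≤ n) {S : Finset (Fin n)} (hS : S.Nonempty) :
    ∑ S', supportChain n S S' * lyapunov n S' ≤ 9 / 10 * lyapunov n S + 40 * 80800 / n ^ 2 := by
  have hn' : (80800 : ℝ) ≤ n := by exact_mod_cast hn
  have hn0 : (0 : ℝ) < n := by linarith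
  have hs0 : (1 : ℝ) ≤ S.card := by exact_mod_cast hS.card_pos
  have hD : 80800 / (n : ℝ) ≤ 1 := by rw [div_le_one hn0]; exact hn'
  have hβ : 0 ≤ 40 * 80800 / (n : ℝ) ^ 2 := by positivity
  have hcard : ∀ S', supportChain n S S' ≠ 0 → (1 : ℝ) ≤ S'.card := by
    intro S' h
    have h1 := half_card_le_of_supportChain h
    have h2 : (0 : ℝ) < S'.card := by linarith
    have : 0 < S'.card := by exact_mod_cast h2
    exact_mod_cast this
  have mono : ∀ F G : Finset (Fin n) → ℝ, (∀ S', supportChain n S S' ≠ 0 → F S' ≤ G S') →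
      ∑ S', supportChain n S S' * F S' ≤ ∑ S', supportChain n S S' * G S' := by
    intro F G h
    refine Finset.sum_le_sum fun S' _ => ?_
    by_cases h0 : supportChain n S S' = 0
    · simp [h0]
    · exact mul_le_mul_of_nonneg_left (h S' h0) (supportChain_nonneg S S')
  have hmax : max 1 (S.card : ℝ) = S.card := max_eq_right hs0
  by_cases hA : (S.card : ℝ) ≤ n / 40
  · have h1 : ∑ S', supportChain n S S' * lyapunov n S'
        ≤ ∑ S', supportChain n S S' * (1 / (S'.card : ℝ)) := by
      refine mono _ _ fun S' h => ?_
      have hc := hcard S' h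
      rw [lyapunov, max_eq_right hc]
      refine mul_le_of_le_one_left (by positivity) ?_
      split_ifs <;> linarith
    have h2 := sum_supportChain_inv_card_le (by omega) hS (by linarith)
    rw [lyapunov, if_pos hA, hmax]
    have h3 : 0 ≤ 1 / (S.card : ℝ) := by positivity
    have h4 : 8 / 10 / (S.card : ℝ) = 8 / 10 * (1 / S.card) := by ring
    linarith
  push Not at hA
  have hφ : lyapunov n S = 80800 / n * (1 / S.card) := by
    rw [lyapunov, if_neg (not_le.2 hA), hmax]
  by_cases hB : (S.card : ℝ) ≤ n / 20
  · have h1 : ∑ S', supportChain n S S' * lyapunov n S'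
        ≤ ∑ S', supportChain n S S' * (2 / S.card * (if S'.card < S.card then 1 else 0)
          + 80800 / n * (1 / (S'.card : ℝ))) := by
      refine mono _ _ fun S' h => ?_
      have hc := hcard S' h
      have hh := half_card_le_of_supportChain h
      rw [lyapunov, max_eq_right hc]
      by_cases hlt : S'.card < S.card
      · rw [if_pos hlt, mul_one]
        have h3 : 1 / (S'.card : ℝ) ≤ 2 / S.card := by
          rw [div_le_div_iff₀ (by linarith) (by linarith)]
          linarith
        have h4 : 0 ≤ 80800 / (n : ℝ) * (1 / (S'.card : ℝ)) := by positivity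
        split_ifs <;> [linarith; exact le_add_of_nonneg_left (by positivity)]
      · have h5 : ¬ (S'.card : ℝ) ≤ n / 40 := by
          have : (S.card : ℝ) ≤ S'.card := by exact_mod_cast not_lt.1 hlt
          linarith
        rw [if_neg hlt, if_neg h5, mul_zero, zero_add]
    have e : ∑ S', supportChain n S S' * (2 / S.card * (if S'.card < S.card then 1 else 0)
          + 80800 / n * (1 / (S'.card : ℝ)))
        = 2 / S.card * ∑ S', supportChain n S S' * (if S'.card < S.card then 1 else 0)
          + 80800 / n * ∑ S', supportChain n S S' * (1 / (S'.card : ℝ)) := by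
      rw [Finset.mul_sum, Finset.mul_sum, ← Finset.sum_add_distrib]
      refine Finset.sum_congr rfl fun _ _ => ?_
      ring
    have h2 := sum_supportChain_inv_card_le (by omega) hS (by linarith)
    have h3 := sum_supportChain_card_lt_le (by omega) hS (by linarith)
    calc _ ≤ _ := h1
      _ = _ := e
      _ ≤ 2 / S.card * (101 / S.card) + 80800 / n * (8 / 10 / S.card) := by gcongr
      _ ≤ 8080 / n * (1 / S.card) + 80800 / n * (8 / 10 / S.card) := by
          refine add_le_add ?_ le_rfl
          rw [div_mul_div_comm, div_mul_div_comm, div_le_div_iff₀ (by positivity) (by positivity)]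
          nlinarith
      _ = 9 / 10 * lyapunov n S := by rw [hφ]; ring
      _ ≤ _ := by linarith
  · push Not at hB
    have h1 : ∑ S', supportChain n S S' * lyapunov n S'
        ≤ ∑ S', supportChain n S S' * (40 * 80800 / (n : ℝ) ^ 2) := by
      refine mono _ _ fun S' h => ?_
      have hc := hcard S' h
      have hh := half_card_le_of_supportChain h
      have h5 : ¬ (S'.card : ℝ) ≤ n / 40 := by linarith
      rw [lyapunov, max_eq_right hc, if_neg h5, div_mul_div_comm,
        div_le_div_iff₀ (by positivity) (by positivity)]
      nlinarith
    rw [← Finset.sum_mul, sum_supportChain, one_mul] at h1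
    have : 0 ≤ lyapunov n S := by rw [hφ]; positivity
    linarith

theorem lyapunov_nonneg (S : Finset (Fin n)) : 0 ≤ lyapunov n S := by
  unfold lyapunov
  have : (0 : ℝ) < max 1 (S.card : ℝ) := lt_max_of_lt_left one_pos
  positivity

theorem sum_supportChain_pow_lyapunov (hn : 80800 ≤ n) (t : ℕ) {S : Finset (Fin n)}
    (hS : S.Nonempty) : ∑ S', (supportChain n ^ t) S S' * lyapunov n S'
      ≤ (9 / 10) ^ t * lyapunov n S + (1 - (9 / 10) ^ t) * (400 * 80800 / n ^ 2) := by
  induction t generalizing S with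
  | zero =>
    simp [Matrix.one_apply]
  | succ t ih =>
    have e : ∑ S', (supportChain n ^ (t + 1)) S S' * lyapunov n S'
        = ∑ T, supportChain n S T * ∑ S', (supportChain n ^ t) T S' * lyapunov n S' := by
      simp only [pow_succ', Matrix.mul_apply, Finset.sum_mul, Finset.mul_sum]
      rw [Finset.sum_comm]
      simp only [mul_assoc]
    rw [e]
    calc _ ≤ ∑ T, supportChain n S T *
          ((9 / 10) ^ t * lyapunov n T + (1 - (9 / 10) ^ t) * (400 * 80800 / n ^ 2)) := by
          refine Finset.sum_le_sum fun T _ => ?_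
          by_cases h0 : supportChain n S T = 0
          · simp [h0]
          refine mul_le_mul_of_nonneg_left (ih ?_) (supportChain_nonneg S T)
          have h1 := half_card_le_of_supportChain h0
          have h2 : (0 : ℝ) < S.card := by exact_mod_cast hS.card_pos
          have h3 : (0 : ℝ) < T.card := by linarith
          exact Finset.card_pos.1 (by exact_mod_cast h3)
      _ = (9 / 10) ^ t * ∑ T, supportChain n S T * lyapunov n T
          + (1 - (9 / 10) ^ t) * (400 * 80800 / n ^ 2) := by
          simp only [mul_add, Finset.sum_add_distrib, ← Finset.sum_mul, sum_supportChain, one_mul,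
            Finset.mul_sum]
          congr 1
          refine Finset.sum_congr rfl fun _ _ => ?_
          ring
      _ ≤ (9 / 10) ^ t * (9 / 10 * lyapunov n S + 40 * 80800 / n ^ 2)
          + (1 - (9 / 10) ^ t) * (400 * 80800 / n ^ 2) := by
          gcongr
          exact lyapunov_drift hn hS
      _ = _ := by ring

theorem probSupportLE_le_one (S : Finset (Fin n)) (t : ℕ) (r : ℝ) : probSupportLE S t r ≤ 1 := by
  rw [← sum_supportChain_pow t S]
  exact Finset.sum_le_sum_of_subset_of_nonneg (Finset.filter_subset _ _)
    fun S' _ _ => supportChain_pow_nonneg t S S'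

theorem probSupportLE_mono (S : Finset (Fin n)) (t : ℕ) {r r' : ℝ} (h : r ≤ r') :
    probSupportLE S t r ≤ probSupportLE S t r' := by
  refine Finset.sum_le_sum_of_subset_of_nonneg (fun S' => ?_)
    fun S' _ _ => supportChain_pow_nonneg t S S'
  simpa using fun hr : (S'.card : ℝ) ≤ r => hr.trans h

/-- After `20 log n` steps the support has linear size, up to an error of order `1 / n`. -/
theorem probSupportLE_le (hn : 1 ≤ n) {S : Finset (Fin n)} (hS : S.Nonempty) {t : ℕ}
    (ht : 20 * Real.log n ≤ t) : probSupportLE S t (n / 40) ≤ 1000000 / n := by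
  have hn0 : (1 : ℝ) ≤ n := by exact_mod_cast hn
  by_cases hsmall : n < 80800
  · refine (probSupportLE_le_one S t _).trans ?_
    rw [le_div_iff₀ (by linarith)]
    have : (n : ℝ) < 80800 := by exact_mod_cast hsmall
    linarith
  have hbig : 80800 ≤ n := not_lt.1 hsmall
  have hn' : (80800 : ℝ) ≤ n := by exact_mod_cast hbig
  have h1 : probSupportLE S t (n / 40)
      ≤ ∑ S', (supportChain n ^ t) S S' * (n / 40 * lyapunov n S') := by
    rw [probSupportLE, Finset.sum_filter]
    refine Finset.sum_le_sum fun S' _ => ?_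
    have h0 := supportChain_pow_nonneg t S S'
    split_ifs with h
    · refine le_mul_of_one_le_right h0 ?_
      have hm : (0 : ℝ) < max 1 (S'.card : ℝ) := lt_max_of_lt_left one_pos
      rw [lyapunov, if_pos h, one_mul, mul_one_div, le_div_iff₀ hm, one_mul]
      exact max_le (by linarith) h
    · exact mul_nonneg h0 (mul_nonneg (by positivity) (lyapunov_nonneg S'))
  have h2 := sum_supportChain_pow_lyapunov hbig t hS
  have h2' : (1 - (9 / 10 : ℝ) ^ t) * (400 * 80800 / n ^ 2) ≤ 400 * 80800 / n ^ 2 :=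
    mul_le_of_le_one_left (by positivity) (by
      have : (0 : ℝ) ≤ (9 / 10 : ℝ) ^ t := by positivity
      linarith)
  have h3 : lyapunov n S ≤ 1 := by
    unfold lyapunov
    refine mul_le_one₀ ?_ (by positivity) ?_
    · split_ifs
      · exact le_rfl
      · rw [div_le_one (by linarith)]
        exact hn'
    · exact div_le_one_of_le₀ (le_max_left _ _) (by positivity)
  have h4 : (9 / 10 : ℝ) ^ t ≤ 1 / n ^ 2 := by
    have a : (9 / 10 : ℝ) ≤ Real.exp (-(1 / 10)) := by
      have := Real.add_one_le_exp (-(1 / 10) : ℝ)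
      linarith
    calc (9 / 10 : ℝ) ^ t ≤ Real.exp (-(1 / 10)) ^ t := pow_le_pow_left₀ (by norm_num) a t
      _ = Real.exp (-(t / 10)) := by rw [← Real.exp_nat_mul]; congr 1; ring
      _ ≤ Real.exp (-(2 * Real.log n)) := by
          refine Real.exp_le_exp.2 ?_
          linarith
      _ = 1 / n ^ 2 := by
          rw [Real.exp_neg, one_div, two_mul, Real.exp_add, Real.exp_log (by linarith), sq]
  have e : ∑ S', (supportChain n ^ t) S S' * (n / 40 * lyapunov n S')
      = n / 40 * ∑ S', (supportChain n ^ t) S S' * lyapunov n S' := by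
    rw [Finset.mul_sum]
    refine Finset.sum_congr rfl fun _ _ => ?_
    ring
  calc _ ≤ _ := h1
    _ = _ := e
    _ ≤ n / 40 * ((9 / 10) ^ t * lyapunov n S + 400 * 80800 / n ^ 2) := by
        gcongr
        linarith
    _ ≤ n / 40 * (1 / n ^ 2 * 1 + 400 * 80800 / n ^ 2) := by
        gcongr
        exact lyapunov_nonneg S
    _ ≤ 1000000 / n := by
        have : (n : ℝ) / 40 * (1 / n ^ 2 * 1 + 400 * 80800 / n ^ 2) = (1 / 40 + 808000) / n := by
          field_simp
          norm_num
        rw [this]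
        gcongr
        norm_num

end Chain

/-! ### Pauli strings and Pauli coefficients -/

section Pauli

theorem pauli_conjTranspose (a : Fin 4) : (pauli a).conjTranspose = pauli a := by
  fin_cases a <;> ext i j <;> fin_cases i <;> fin_cases j <;> simp [pauli]

theorem star_pauli_apply (a : Fin 4) (x y : Fin 2) : star (pauli a x y) = pauli a y x := by
  conv_rhs => rw [← pauli_conjTranspose a]
  rfl

theorem sum_pauli_mul_pauli (x y z w : Fin 2) :
    ∑ a, pauli a x y * pauli a z w = if x = w ∧ y = z then 2 else 0 := by
  fin_cases x <;> fin_cases y <;> fin_cases z <;> fin_cases w <;>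
    simp [Fin.sum_univ_four, pauli] <;> norm_num

theorem trace_pauli_mul_pauli (a b : Fin 4) :
    (pauli a * pauli b).trace = if a = b then 2 else 0 := by
  fin_cases a <;> fin_cases b <;>
    simp [Matrix.trace, Fin.sum_univ_two, pauli] <;> norm_num

variable {ι : Type} [Fintype ι]

/-- The tensor product of the Pauli matrices `σ_{a i}`. -/
def pauliString (a : ι → Fin 4) : Matrix (Bits ι) (Bits ι) ℂ := fun x y =>
  ∏ i, pauli (a i) (x i) (y i)

theorem pauliString_conjTranspose (a : ι → Fin 4) :
    (pauliString a).conjTranspose = pauliString a := by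
  ext x y
  simp only [Matrix.conjTranspose_apply, pauliString, star_prod, star_pauli_apply]

theorem star_pauliString_apply (a : ι → Fin 4) (x y : Bits ι) :
    star (pauliString a x y) = pauliString a y x := by
  conv_rhs => rw [← pauliString_conjTranspose a]
  rfl

theorem sum_pauliString_mul [DecidableEq ι] (x y z w : Bits ι) :
    ∑ a, pauliString a x y * pauliString a z w
      = if x = w ∧ y = z then (2 : ℂ) ^ Fintype.card ι else 0 := by
  simp only [pauliString, ← Finset.prod_mul_distrib]
  rw [← Fintype.prod_sum (fun i a => pauli a (x i) (y i) * pauli a (z i) (w i))]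
  simp only [sum_pauli_mul_pauli]
  rw [Finset.prod_ite_zero, Finset.prod_const, Finset.card_univ]
  simp [funext_iff, forall_and]

theorem sum_sum_prod_bits [DecidableEq ι] (f : ι → Fin 2 → Fin 2 → ℂ) :
    ∑ x : Bits ι, ∑ y : Bits ι, ∏ i, f i (x i) (y i) = ∏ i, ∑ a, ∑ b, f i a b := by
  rw [Fintype.prod_sum]
  refine Finset.sum_congr rfl fun x _ => ?_
  rw [Fintype.prod_sum]

theorem trace_pauliString_mul [DecidableEq ι] (a b : ι → Fin 4) :
    (pauliString a * pauliString b).trace = if a = b then (2 : ℂ) ^ Fintype.card ι else 0 := by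
  have h : (pauliString a * pauliString b).trace = ∏ i, (pauli (a i) * pauli (b i)).trace := by
    simp only [Matrix.trace, Matrix.diag_apply, Matrix.mul_apply, pauliString,
      ← Finset.prod_mul_distrib]
    exact sum_sum_prod_bits fun i p q => pauli (a i) p q * pauli (b i) q p
  rw [h]
  simp only [trace_pauli_mul_pauli]
  rw [Finset.prod_ite_zero, Finset.prod_const, Finset.card_univ]
  simp [funext_iff]

theorem pauliString_zero [DecidableEq ι] : pauliString (fun _ : ι => 0) = 1 := by
  ext x y
  simp only [pauliString, pauli, Matrix.one_apply]
  rw [Finset.prod_ite_zero]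
  simp [funext_iff]

theorem trace_mul_eq_sum {B : Type*} [Fintype B] (X Y : Matrix B B ℂ) :
    (X * Y).trace = ∑ p : B × B, X p.1 p.2 * Y p.2 p.1 := by
  simp [Matrix.trace, Matrix.mul_apply, Fintype.sum_prod_type]

/-- A Hermitian orthogonal basis of the matrices, of squared norm `D`. -/
structure IsHermitianBasis {J B : Type*} [Fintype J] [Fintype B] [DecidableEq J] [DecidableEq B]
    (e : J → Matrix B B ℂ) (D : ℝ) : Prop where
  pos : 0 < D
  conjTranspose : ∀ a, (e a).conjTranspose = e a
  complete : ∀ x y z w, ∑ a, e a x y * e a z w = if x = w ∧ y = z then (D : ℂ) else 0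
  trace_mul : ∀ a b, (e a * e b).trace = if a = b then (D : ℂ) else 0

/-- The coefficient at `e b` of `U (e a) Uᴴ`. -/
def basisCoeff {J B : Type*} [Fintype B] (e : J → Matrix B B ℂ) (D : ℝ) (U : Matrix B B ℂ)
    (b a : J) : ℝ := ((D : ℂ)⁻¹ * (e b * (U * e a * U.conjTranspose)).trace).re

namespace IsHermitianBasis

variable {J B : Type*} [Fintype J] [Fintype B] [DecidableEq J] [DecidableEq B]
  {e : J → Matrix B B ℂ} {D : ℝ}

theorem sum_trace (h : IsHermitianBasis e D) (X Y : Matrix B B ℂ) :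
    ∑ a, (e a * X).trace * (e a * Y).trace = D * (X * Y).trace := by
  have h1 : ∀ a, (e a * X).trace * (e a * Y).trace = ∑ p : B × B, ∑ q : B × B,
      e a p.1 p.2 * e a q.1 q.2 * (X p.2 p.1 * Y q.2 q.1) := by
    intro a
    rw [trace_mul_eq_sum, trace_mul_eq_sum, Finset.sum_mul_sum]
    refine Finset.sum_congr rfl fun p _ => Finset.sum_congr rfl fun q _ => ?_
    ring
  simp only [h1]
  rw [Finset.sum_comm, Matrix.trace_mul_comm, trace_mul_eq_sum, Finset.mul_sum]
  refine Finset.sum_congr rfl fun p _ => ?_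
  rw [Finset.sum_comm]
  simp only [← Finset.sum_mul, h.complete]
  rw [Finset.sum_eq_single (p.2, p.1)]
  · simp [mul_comm]
  · intro q _ hq
    rw [if_neg, zero_mul]
    exact fun hc => hq (Prod.ext hc.2.symm hc.1.symm)
  · simp

theorem coe_basisCoeff (h : IsHermitianBasis e D) (U : Matrix B B ℂ) (b a : J) :
    (basisCoeff e D U b a : ℂ) = (D : ℂ)⁻¹ * (e b * (U * e a * U.conjTranspose)).trace := by
  rw [basisCoeff, ← Complex.conj_eq_iff_re, map_mul, map_inv₀, Complex.conj_ofReal]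
  congr 1
  change star _ = _
  rw [← Matrix.trace_conjTranspose, Matrix.conjTranspose_mul, Matrix.conjTranspose_mul,
    Matrix.conjTranspose_mul, Matrix.conjTranspose_conjTranspose, h.conjTranspose,
    h.conjTranspose, Matrix.trace_mul_comm, Matrix.mul_assoc U]

theorem basisCoeff_one (h : IsHermitianBasis e D) (b a : J) :
    basisCoeff e D 1 b a = if b = a then 1 else 0 := by
  have hD : (D : ℂ) ≠ 0 := by exact_mod_cast h.pos.ne'
  have := h.coe_basisCoeff 1 b a
  rw [Matrix.conjTranspose_one, Matrix.one_mul, Matrix.mul_one, h.trace_mul] at this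
  split_ifs at this ⊢
  · rw [inv_mul_cancel₀ hD] at this
    exact_mod_cast this
  · rw [mul_zero] at this
    exact_mod_cast this

theorem basisCoeff_mul (h : IsHermitianBasis e D) (U V : Matrix B B ℂ) (b a : J) :
    basisCoeff e D (U * V) b a = ∑ c, basisCoeff e D U b c * basisCoeff e D V c a := by
  have hD : (D : ℂ) ≠ 0 := by exact_mod_cast h.pos.ne'
  have key : ((basisCoeff e D (U * V) b a : ℝ) : ℂ)
      = ∑ c, (basisCoeff e D U b c : ℂ) * (basisCoeff e D V c a : ℂ) := by
    simp only [h.coe_basisCoeff]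
    have h1 := h.sum_trace (U.conjTranspose * e b * U) (V * e a * V.conjTranspose)
    have h2 : ∀ c, (e b * (U * e c * U.conjTranspose)).trace
        = (e c * (U.conjTranspose * e b * U)).trace := by
      intro c
      rw [Matrix.trace_mul_comm, Matrix.mul_assoc, Matrix.mul_assoc, Matrix.trace_mul_comm,
        Matrix.mul_assoc]
    have h3 : (e b * (U * V * e a * (U * V).conjTranspose)).trace
        = (U.conjTranspose * e b * U * (V * e a * V.conjTranspose)).trace := by
      rw [Matrix.conjTranspose_mul, Matrix.mul_assoc (U.conjTranspose * e b),
        Matrix.mul_assoc U.conjTranspose, Matrix.trace_mul_comm U.conjTranspose]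
      simp only [Matrix.mul_assoc]
    have h4 : ∀ c, (D : ℂ)⁻¹ * (e b * (U * e c * U.conjTranspose)).trace
        * ((D : ℂ)⁻¹ * (e c * (V * e a * V.conjTranspose)).trace)
        = (D : ℂ)⁻¹ * (D : ℂ)⁻¹ * ((e c * (U.conjTranspose * e b * U)).trace
          * (e c * (V * e a * V.conjTranspose)).trace) := by
      intro c
      rw [h2]
      ring
    simp only [h4]
    rw [← Finset.mul_sum, h1, h3]
    field_simp
  exact_mod_cast key

theorem basisCoeff_conjTranspose (h : IsHermitianBasis e D) (U : Matrix B B ℂ) (b a : J) :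
    basisCoeff e D U.conjTranspose b a = basisCoeff e D U a b := by
  have key : ((basisCoeff e D U.conjTranspose b a : ℝ) : ℂ) = (basisCoeff e D U a b : ℝ) := by
    rw [h.coe_basisCoeff, h.coe_basisCoeff, Matrix.conjTranspose_conjTranspose,
      Matrix.trace_mul_comm]
    congr 1
    rw [Matrix.mul_assoc, Matrix.mul_assoc, Matrix.trace_mul_comm, Matrix.mul_assoc,
      Matrix.mul_assoc]
  exact_mod_cast key

theorem sum_basisCoeff_sq (h : IsHermitianBasis e D) {U : Matrix B B ℂ}
    (hU : U.conjTranspose * U = 1) (a : J) : ∑ b, basisCoeff e D U b a ^ 2 = 1 := by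
  have h1 := h.basisCoeff_mul U.conjTranspose U a a
  rw [hU, h.basisCoeff_one, if_pos rfl] at h1
  rw [h1]
  refine Finset.sum_congr rfl fun b _ => ?_
  rw [h.basisCoeff_conjTranspose, sq]

/-- The basis element `1` is preserved. -/
theorem basisCoeff_of_eq_one (h : IsHermitianBasis e D) {U : Matrix B B ℂ}
    (hU : U * U.conjTranspose = 1) {a : J} (ha : e a = 1) (b : J) :
    basisCoeff e D U b a = if b = a then 1 else 0 := by
  rw [← h.basisCoeff_one, basisCoeff, basisCoeff, ha, Matrix.mul_one, hU]
  simp only [Matrix.conjTranspose_one, Matrix.mul_one]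

end IsHermitianBasis

theorem pauliString_isHermitianBasis [DecidableEq ι] :
    IsHermitianBasis (pauliString : (ι → Fin 4) → _) (2 ^ Fintype.card ι) where
  pos := by positivity
  conjTranspose := pauliString_conjTranspose
  complete x y z w := by rw [sum_pauliString_mul]; push_cast; rfl
  trace_mul a b := by rw [trace_pauliString_mul]; push_cast; rfl

/-- The two-qubit Pauli matrices. -/
def pauli₂ (b : Fin 4 × Fin 4) : Matrix (Fin 2 × Fin 2) (Fin 2 × Fin 2) ℂ :=
  pauli b.1 ⊗ₖ pauli b.2

theorem pauli₂_zero : pauli₂ 0 = 1 := by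
  change (1 : Matrix (Fin 2) (Fin 2) ℂ) ⊗ₖ (1 : Matrix (Fin 2) (Fin 2) ℂ) = 1
  exact Matrix.one_kronecker_one

theorem pauli₂_apply (c : Fin 4 × Fin 4) (x y : Fin 2 × Fin 2) :
    pauli₂ c x y = pauli c.1 x.1 y.1 * pauli c.2 x.2 y.2 := rfl

theorem pauli₂_isHermitianBasis : IsHermitianBasis pauli₂ 4 where
  pos := by norm_num
  conjTranspose a := by
    rw [pauli₂, Matrix.conjTranspose_kronecker, pauli_conjTranspose, pauli_conjTranspose]
  complete x y z w := by
    simp only [pauli₂_apply, Fintype.sum_prod_type]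
    have : ∀ a b : Fin 4, pauli a x.1 y.1 * pauli b x.2 y.2 * (pauli a z.1 w.1 * pauli b z.2 w.2)
        = (pauli a x.1 y.1 * pauli a z.1 w.1) * (pauli b x.2 y.2 * pauli b z.2 w.2) := by
      intro a b; ring
    simp only [this]
    rw [← Finset.sum_mul_sum, sum_pauli_mul_pauli, sum_pauli_mul_pauli]
    simp only [Prod.ext_iff]
    split_ifs <;> first | (exfalso; tauto) | norm_num
  trace_mul a b := by
    rw [pauli₂, pauli₂, ← Matrix.mul_kronecker_mul, Matrix.trace_kronecker, trace_pauli_mul_pauli,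
      trace_pauli_mul_pauli]
    simp only [Prod.ext_iff]
    split_ifs <;> first | (exfalso; tauto) | norm_num

/-- The coefficients of a two-qubit gate. -/
abbrev gateCoeff (G : Matrix (Fin 2 × Fin 2) (Fin 2 × Fin 2) ℂ) (b a : Fin 4 × Fin 4) : ℝ :=
  basisCoeff pauli₂ 4 G b a

/-- The coefficients of an operator on the qubits labelled by `ι`. -/
abbrev pauliCoeff [DecidableEq ι] (U : Matrix (Bits ι) (Bits ι) ℂ) (b a : ι → Fin 4) : ℝ :=
  basisCoeff pauliString (2 ^ Fintype.card ι) U b a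

end Pauli

/-! ### Operators that factorize over the pairs of a matching -/

section PairMat

variable {n : ℕ}

/-- The tensor product of operators on the pairs and on the fixed points of a matching. -/
def pairMat (σ : Matching n) (g : Fin n → Matrix (Fin 2 × Fin 2) (Fin 2 × Fin 2) ℂ)
    (h : Fin n → Matrix (Fin 2) (Fin 2) ℂ) : Matrix (Bits (Fin n)) (Bits (Fin n)) ℂ := fun x y =>
  (∏ i with i < σ.1 i, g i (x i, x (σ.1 i)) (y i, y (σ.1 i))) *
    ∏ i with σ.1 i = i, h i (x i) (y i)

theorem pairMat_mul (σ : Matching n) (g g' : Fin n → Matrix (Fin 2 × Fin 2) (Fin 2 × Fin 2) ℂ)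
    (h h' : Fin n → Matrix (Fin 2) (Fin 2) ℂ) :
    pairMat σ g h * pairMat σ g' h' = pairMat σ (fun i => g i * g' i) fun i => h i * h' i := by
  ext x y
  rw [Matrix.mul_apply]
  simp only [pairMat]
  have := sum_prod_matching σ
    (fun i a b => g i (x i, x (σ.1 i)) (a, b) * g' i (a, b) (y i, y (σ.1 i)))
    (fun i a => h i (x i) a * h' i a (y i))
  simp only [Matrix.mul_apply, Fintype.sum_prod_type]
  rw [← this]
  refine Finset.sum_congr rfl fun z _ => ?_
  rw [Finset.prod_mul_distrib, Finset.prod_mul_distrib]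
  ring

theorem trace_pairMat (σ : Matching n) (g : Fin n → Matrix (Fin 2 × Fin 2) (Fin 2 × Fin 2) ℂ)
    (h : Fin n → Matrix (Fin 2) (Fin 2) ℂ) :
    (pairMat σ g h).trace = (∏ i with i < σ.1 i, (g i).trace) *
      ∏ i with σ.1 i = i, (h i).trace := by
  have := sum_prod_matching σ (fun i a b => g i (a, b) (a, b)) (fun i a => h i a a)
  simp only [Matrix.trace, Matrix.diag_apply, Fintype.sum_prod_type]
  exact this

theorem pairMat_conjTranspose (σ : Matching n)
    (g : Fin n → Matrix (Fin 2 × Fin 2) (Fin 2 × Fin 2) ℂ) (h : Fin n → Matrix (Fin 2) (Fin 2) ℂ) :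
    (pairMat σ g h).conjTranspose
      = pairMat σ (fun i => (g i).conjTranspose) fun i => (h i).conjTranspose := by
  ext x y
  simp only [pairMat, Matrix.conjTranspose_apply, star_mul', star_prod]

theorem pauliString_eq_pairMat (σ : Matching n) (a : Fin n → Fin 4) :
    pauliString a = pairMat σ (fun i => pauli₂ (a i, a (σ.1 i))) fun i => pauli (a i) := by
  ext x y
  exact prod_matching σ fun i => pauli (a i) (x i) (y i)

theorem pairMat_one (σ : Matching n) : pairMat σ (fun _ => 1) (fun _ => 1) = 1 := by
  rw [← pauliString_zero, pauliString_eq_pairMat σ]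
  congr 1
  funext i
  exact pauli₂_zero.symm

theorem layerMatrix_eq (L : Layer n) :
    layerMatrix L = pairMat L.1 (fun i => (L.2 i : Matrix _ _ ℂ)) fun _ => 1 := by
  ext x y
  simp only [layerMatrix, pairMat, Matrix.one_apply]

theorem layerMatrix_mul_conjTranspose (L : Layer n) :
    layerMatrix L * (layerMatrix L).conjTranspose = 1 := by
  rw [layerMatrix_eq, pairMat_conjTranspose, pairMat_mul, ← pairMat_one L.1]
  congr 1
  · funext i
    exact Matrix.mem_unitaryGroup_iff.1 (L.2 i).2
  · funext i
    simp

theorem circuitMatrix_mul_conjTranspose : ∀ {t : ℕ} (w : Fin t → Layer n),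
    circuitMatrix w * (circuitMatrix w).conjTranspose = 1
  | 0, _ => by simp [circuitMatrix]
  | t + 1, w => by
    rw [circuitMatrix, Matrix.conjTranspose_mul, Matrix.mul_assoc, ← Matrix.mul_assoc
      (circuitMatrix _), circuitMatrix_mul_conjTranspose, Matrix.one_mul,
      layerMatrix_mul_conjTranspose]

theorem circuitMatrix_conjTranspose_mul {t : ℕ} (w : Fin t → Layer n) :
    (circuitMatrix w).conjTranspose * circuitMatrix w = 1 :=
  mul_eq_one_comm.1 (circuitMatrix_mul_conjTranspose w)

theorem pauliCoeff_layerMatrix (L : Layer n) (b a : Fin n → Fin 4) :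
    pauliCoeff (layerMatrix L) b a
      = (∏ i with i < L.1.1 i, gateCoeff (L.2 i : Matrix _ _ ℂ) (b i, b (L.1.1 i))
          (a i, a (L.1.1 i))) * ∏ i with L.1.1 i = i, if b i = a i then 1 else 0 := by
  have key : (pauliCoeff (layerMatrix L) b a : ℂ)
      = (∏ i with i < L.1.1 i, (gateCoeff (L.2 i : Matrix _ _ ℂ) (b i, b (L.1.1 i))
          (a i, a (L.1.1 i)) : ℂ)) * ∏ i with L.1.1 i = i, if b i = a i then 1 else 0 := by
    have hD : ((2 : ℂ) ^ Fintype.card (Fin n))⁻¹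
        = (∏ i with i < L.1.1 i, (4 : ℂ)⁻¹) * ∏ i with L.1.1 i = i, (2 : ℂ)⁻¹ := by
      have := prod_matching L.1 fun _ : Fin n => (2 : ℂ)⁻¹
      rw [Finset.prod_const, Finset.card_univ, inv_pow] at this
      rw [this]
      norm_num
    simp only [pauliCoeff, gateCoeff, pauliString_isHermitianBasis.coe_basisCoeff,
      pauli₂_isHermitianBasis.coe_basisCoeff]
    push_cast
    rw [hD, layerMatrix_eq, pauliString_eq_pairMat L.1, pauliString_eq_pairMat L.1,
      pairMat_conjTranspose, pairMat_mul, pairMat_mul, pairMat_mul, trace_pairMat,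
      Finset.prod_mul_distrib, mul_mul_mul_comm]
    congr 1
    rw [← Finset.prod_mul_distrib]
    refine Finset.prod_congr rfl fun i _ => ?_
    rw [Matrix.one_mul, Matrix.conjTranspose_one, Matrix.mul_one, trace_pauli_mul_pauli]
    split_ifs <;> norm_num
  have h2 : ((∏ i with i < L.1.1 i, (gateCoeff (L.2 i : Matrix _ _ ℂ) (b i, b (L.1.1 i))
      (a i, a (L.1.1 i)) : ℂ)) * ∏ i with L.1.1 i = i, if b i = a i then (1 : ℂ) else 0)
      = (((∏ i with i < L.1.1 i, gateCoeff (L.2 i : Matrix _ _ ℂ) (b i, b (L.1.1 i))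
          (a i, a (L.1.1 i))) * ∏ i with L.1.1 i = i, if b i = a i then (1 : ℝ) else 0 : ℝ) : ℂ) := by
    rw [Complex.ofReal_mul, Complex.ofReal_prod, Complex.ofReal_prod]
    congr 1
    refine Finset.prod_congr rfl fun i _ => ?_
    split_ifs <;> simp
  rw [h2] at key
  exact_mod_cast key

end PairMat

/-! ### Pauli and Clifford gates -/

section Clifford

/-- The sign in `σ_a σ_b = ± σ_b σ_a`. -/
def pauliSign (a b : Fin 4) : ℤ := if a = 0 ∨ b = 0 ∨ a = b then 1 else -1

/-- The sign in the commutation of two-qubit Pauli matrices. -/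
def pauliSign₂ (a b : Fin 4 × Fin 4) : ℤ := pauliSign a.1 b.1 * pauliSign a.2 b.2

theorem pauliSign₂_eq (a b : Fin 4 × Fin 4) : pauliSign₂ a b = 1 ∨ pauliSign₂ a b = -1 := by
  unfold pauliSign₂ pauliSign
  split_ifs <;> simp

theorem exists_pauliSign₂_ne : ∀ a a' : Fin 4 × Fin 4, a ≠ a' →
    ∃ c, pauliSign₂ a c * pauliSign₂ a' c = -1 := by
  decide

theorem exists_pauliSign₂_eq_neg_one : ∀ b b' : Fin 4 × Fin 4, b ≠ 0 → b' ≠ 0 →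
    ∃ c, pauliSign₂ b c = -1 ∧ pauliSign₂ c b' = -1 := by
  decide

theorem pauli_comm (a b : Fin 4) :
    pauli a * pauli b = (pauliSign a b : ℂ) • (pauli b * pauli a) := by
  fin_cases a <;> fin_cases b <;> ext i j <;> fin_cases i <;> fin_cases j <;>
    simp [pauli, pauliSign]

theorem pauli₂_comm (a b : Fin 4 × Fin 4) :
    pauli₂ a * pauli₂ b = (pauliSign₂ a b : ℂ) • (pauli₂ b * pauli₂ a) := by
  rw [pauli₂, pauli₂, ← Matrix.mul_kronecker_mul, ← Matrix.mul_kronecker_mul, pauli_comm a.1,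
    pauli_comm a.2, Matrix.smul_kronecker, Matrix.kronecker_smul, smul_smul, pauliSign₂]
  push_cast
  rfl

theorem pauli_mul_self (a : Fin 4) : pauli a * pauli a = 1 := by
  fin_cases a <;> ext i j <;> fin_cases i <;> fin_cases j <;> simp [pauli]

theorem pauli₂_mul_self (a : Fin 4 × Fin 4) : pauli₂ a * pauli₂ a = 1 := by
  rw [pauli₂, ← Matrix.mul_kronecker_mul, pauli_mul_self, pauli_mul_self, Matrix.one_kronecker_one]

theorem exists_pauli_mul (a b : Fin 4) :
    ∃ (k : ℕ) (c : Fin 4), pauli a * pauli b = Complex.I ^ k • pauli c := by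
  refine ⟨![![0, 0, 0, 0], ![0, 0, 1, 3], ![0, 3, 0, 1], ![0, 1, 3, 0]] a b,
    ![![0, 1, 2, 3], ![1, 0, 3, 2], ![2, 3, 0, 1], ![3, 2, 1, 0]] a b, ?_⟩
  fin_cases a <;> fin_cases b <;> ext i j <;> fin_cases i <;> fin_cases j <;>
    simp [pauli, Complex.I_pow_three]

/-- Pauli matrices up to powers of `i`. -/
def IsPauli (M : Matrix (Fin 2 × Fin 2) (Fin 2 × Fin 2) ℂ) : Prop :=
  ∃ (k : ℕ) (c : Fin 4 × Fin 4), M = Complex.I ^ k • pauli₂ c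

theorem isPauli_pauli₂ (c : Fin 4 × Fin 4) : IsPauli (pauli₂ c) := ⟨0, c, by simp⟩

theorem IsPauli.smul {M : Matrix (Fin 2 × Fin 2) (Fin 2 × Fin 2) ℂ} (h : IsPauli M) (k : ℕ) :
    IsPauli (Complex.I ^ k • M) := by
  obtain ⟨l, c, rfl⟩ := h
  exact ⟨k + l, c, by rw [smul_smul, pow_add]⟩

theorem IsPauli.neg {M : Matrix (Fin 2 × Fin 2) (Fin 2 × Fin 2) ℂ} (h : IsPauli M) :
    IsPauli (-M) := by
  simpa using h.smul 2

theorem IsPauli.mul {M N : Matrix (Fin 2 × Fin 2) (Fin 2 × Fin 2) ℂ} (hM : IsPauli M)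
    (hN : IsPauli N) : IsPauli (M * N) := by
  obtain ⟨k, c, rfl⟩ := hM
  obtain ⟨l, d, rfl⟩ := hN
  rw [Matrix.smul_mul, Matrix.mul_smul]
  refine IsPauli.smul (IsPauli.smul ?_ _) _
  rw [pauli₂, pauli₂, ← Matrix.mul_kronecker_mul]
  obtain ⟨k₁, c₁, h₁⟩ := exists_pauli_mul c.1 d.1
  obtain ⟨k₂, c₂, h₂⟩ := exists_pauli_mul c.2 d.2
  rw [h₁, h₂, Matrix.smul_kronecker, Matrix.kronecker_smul]
  exact ((isPauli_pauli₂ (c₁, c₂)).smul _).smul _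

theorem mem_pauliGroup_iff (P : Gate) : P ∈ pauliGroup ↔ IsPauli (P : Matrix _ _ ℂ) := by
  constructor
  · rintro ⟨k, a, b, h⟩
    exact ⟨k, (a, b), h⟩
  · rintro ⟨k, c, h⟩
    refine ⟨⟨k % 4, Nat.mod_lt _ (by norm_num)⟩, c.1, c.2, ?_⟩
    rw [h]
    congr 1
    conv_lhs => rw [← Nat.div_add_mod k 4, pow_add, pow_mul, Complex.I_pow_four, one_pow, one_mul]

/-- A Hermitian unitary that conjugates Pauli matrices to Pauli matrices, as a gate. -/
theorem exists_cliffordGate {M : Matrix (Fin 2 × Fin 2) (Fin 2 × Fin 2) ℂ}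
    (hM : M.conjTranspose = M) (hM2 : M * M = 1) (h : ∀ c, IsPauli (M * pauli₂ c * M)) :
    ∃ g : Gate, g ∈ cliffordGroup ∧ (g : Matrix _ _ ℂ) = M := by
  have hu : M ∈ Matrix.unitaryGroup (Fin 2 × Fin 2) ℂ := by
    rw [Matrix.mem_unitaryGroup_iff, Matrix.star_eq_conjTranspose, hM, hM2]
  refine ⟨⟨M, hu⟩, ?_, rfl⟩
  set g : Gate := ⟨M, hu⟩ with hg
  have hinv : g⁻¹ = g := by
    rw [inv_eq_iff_mul_eq_one]
    exact Subtype.ext hM2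
  have hconj : ∀ P : Gate, P ∈ pauliGroup → g * P * g ∈ pauliGroup := by
    intro P hP
    rw [mem_pauliGroup_iff] at hP ⊢
    obtain ⟨k, c, hc⟩ := hP
    have : ((g * P * g : Gate) : Matrix _ _ ℂ) = Complex.I ^ k • (M * pauli₂ c * M) := by
      change M * (P : Matrix _ _ ℂ) * M = _
      rw [hc, Matrix.mul_smul, Matrix.smul_mul]
    rw [this]
    exact (h c).smul k
  intro P
  rw [hinv]
  refine ⟨hconj P, fun hP => ?_⟩
  have h1 := hconj _ hP
  have h2 : g * g = 1 := Subtype.ext hM2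
  have h3 : g * (g * P * g) * g = P := by
    rw [← mul_assoc, ← mul_assoc, h2, one_mul, mul_assoc, h2, mul_one]
  rwa [h3] at h1

theorem exists_pauliGate (c : Fin 4 × Fin 4) :
    ∃ g : Gate, g ∈ cliffordGroup ∧ (g : Matrix _ _ ℂ) = pauli₂ c :=
  exists_cliffordGate (pauli₂_isHermitianBasis.conjTranspose c) (pauli₂_mul_self c) fun d =>
    ((isPauli_pauli₂ c).mul (isPauli_pauli₂ d)).mul (isPauli_pauli₂ c)

/-- Two anticommuting Pauli matrices are exchanged by a Clifford gate. -/
theorem exists_swapGate {a b : Fin 4 × Fin 4} (hab : pauliSign₂ a b = -1) :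
    ∃ g : Gate, g ∈ cliffordGroup ∧
      (g : Matrix _ _ ℂ).conjTranspose * pauli₂ a * (g : Matrix _ _ ℂ) = pauli₂ b := by
  set r : ℂ := ((Real.sqrt 2 : ℝ) : ℂ)⁻¹ with hr
  have hr2 : r * r = 1 / 2 := by
    rw [hr, ← mul_inv, ← Complex.ofReal_mul, Real.mul_self_sqrt (by norm_num)]
    norm_num
  have hrs : star r = r := by
    rw [hr, star_inv₀]
    congr 1
    exact Complex.conj_ofReal _
  set P := pauli₂ a
  set Q := pauli₂ b
  have hPQ : Q * P = -(P * Q) := by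
    have := pauli₂_comm a b
    rw [hab] at this
    change pauli₂ b * pauli₂ a = -(pauli₂ a * pauli₂ b)
    rw [this]
    simp
  have hP2 : P * P = 1 := pauli₂_mul_self a
  have hQ2 : Q * Q = 1 := pauli₂_mul_self b
  have hM : (r • (P + Q)).conjTranspose = r • (P + Q) := by
    rw [Matrix.conjTranspose_smul, hrs, Matrix.conjTranspose_add,
      pauli₂_isHermitianBasis.conjTranspose, pauli₂_isHermitianBasis.conjTranspose]
  have hconj : ∀ R, r • (P + Q) * R * (r • (P + Q)) = (1 / 2 : ℂ) • ((P + Q) * R * (P + Q)) := by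
    intro R
    rw [Matrix.smul_mul, Matrix.smul_mul, Matrix.mul_smul, smul_smul, hr2]
  obtain ⟨g, hg, hgM⟩ := exists_cliffordGate (M := r • (P + Q)) hM (by
      have := hconj 1
      rw [Matrix.mul_one, Matrix.mul_one] at this
      rw [this, Matrix.add_mul, Matrix.mul_add, Matrix.mul_add, hP2, hQ2, hPQ]
      have : (1 + P * Q + (-(P * Q) + 1)) = (2 : ℂ) • (1 : Matrix (Fin 2 × Fin 2) (Fin 2 × Fin 2) ℂ) := by
        rw [two_smul]; abel
      rw [this, smul_smul]
      norm_num) (by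
      intro c
      rw [hconj]
      set R := pauli₂ c
      have h1 : P * R = (pauliSign₂ a c : ℂ) • (R * P) := pauli₂_comm a c
      have h2 : Q * R = (pauliSign₂ b c : ℂ) • (R * Q) := pauli₂_comm b c
      have h3 : (P + Q) * R * (P + Q) = (pauliSign₂ a c + pauliSign₂ b c : ℂ) • R
          + (pauliSign₂ a c - pauliSign₂ b c : ℂ) • (R * P * Q) := by
        rw [Matrix.add_mul, h1, h2, Matrix.add_mul, Matrix.mul_add, Matrix.mul_add,
          Matrix.smul_mul, Matrix.smul_mul, Matrix.smul_mul, Matrix.smul_mul,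
          Matrix.mul_assoc R P P, Matrix.mul_assoc R Q Q, Matrix.mul_assoc R Q P, hP2, hQ2, hPQ,
          Matrix.mul_one, Matrix.mul_neg, ← Matrix.mul_assoc]
        module
      rw [h3]
      have hR := isPauli_pauli₂ c
      have hRPQ := (hR.mul (isPauli_pauli₂ a)).mul (isPauli_pauli₂ b)
      rcases pauliSign₂_eq a c with ha | ha <;> rcases pauliSign₂_eq b c with hb | hb <;>
        rw [ha, hb]
      · convert hR using 1
        push_cast
        module
      · convert hRPQ using 1
        push_cast
        module
      · convert hRPQ.neg using 1
        push_cast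
        module
      · convert hR.neg using 1
        push_cast
        module)
  refine ⟨g, hg, ?_⟩
  rw [hgM, hM, hconj, Matrix.add_mul, hP2, hPQ, Matrix.add_mul, Matrix.mul_add, Matrix.mul_add,
    Matrix.neg_mul, Matrix.neg_mul, Matrix.one_mul, Matrix.one_mul, Matrix.mul_assoc P Q Q, hQ2,
    Matrix.mul_assoc P Q P, hPQ, Matrix.mul_neg, ← Matrix.mul_assoc, hP2]
  simp only [Matrix.one_mul, Matrix.mul_one]
  module

end Clifford

/-! ### Second moments of random gates -/

section GateMoments

theorem cliffordGroup_le (𝒢 : GateModel) : cliffordGroup ≤ 𝒢.group := by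
  cases 𝒢
  · exact le_top
  · exact le_rfl

/-- The normalized Haar measure of the group of gates. -/
abbrev gateHaar (𝒢 : GateModel) : Measure 𝒢.group :=
  Measure.haarMeasure (⊤ : TopologicalSpace.PositiveCompacts 𝒢.group)

instance (𝒢 : GateModel) : IsProbabilityMeasure (gateHaar 𝒢) :=
  ⟨by simpa using Measure.haarMeasure_self (K₀ := (⊤ : TopologicalSpace.PositiveCompacts 𝒢.group))⟩

theorem integral_law (𝒢 : GateModel) {f : Gate → ℝ} (hf : Continuous f) :
    ∫ G, f G ∂𝒢.law = ∫ g : 𝒢.group, f g ∂gateHaar 𝒢 :=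
  integral_map measurable_subtype_coe.aemeasurable hf.aestronglyMeasurable

theorem integral_law_mul_left (𝒢 : GateModel) {f : Gate → ℝ} (hf : Continuous f) {h : Gate}
    (hh : h ∈ cliffordGroup) : ∫ G, f (h * G) ∂𝒢.law = ∫ G, f G ∂𝒢.law := by
  rw [integral_law 𝒢 hf,
    integral_law 𝒢 (f := fun G => f (h * G)) (hf.comp (continuous_const_mul h))]
  exact integral_mul_left_eq_self (μ := gateHaar 𝒢) (fun g : 𝒢.group => f g)
    ⟨h, cliffordGroup_le 𝒢 hh⟩

theorem gateHaar_map_mul_right (𝒢 : GateModel) (h : 𝒢.group) :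
    (gateHaar 𝒢).map (· * h) = gateHaar 𝒢 := by
  have : IsProbabilityMeasure ((gateHaar 𝒢).map (· * h)) :=
    Measure.isProbabilityMeasure_map (measurable_mul_const h).aemeasurable
  exact Measure.isHaarMeasure_eq_of_isProbabilityMeasure _ _

instance (𝒢 : GateModel) : (gateHaar 𝒢).IsMulRightInvariant := ⟨gateHaar_map_mul_right 𝒢⟩

theorem integral_law_mul_right (𝒢 : GateModel) {f : Gate → ℝ} (hf : Continuous f) {h : Gate}
    (hh : h ∈ cliffordGroup) : ∫ G, f (G * h) ∂𝒢.law = ∫ G, f G ∂𝒢.law := by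
  rw [integral_law 𝒢 hf,
    integral_law 𝒢 (f := fun G => f (G * h)) (hf.comp (continuous_mul_const h))]
  exact integral_mul_right_eq_self (μ := gateHaar 𝒢) (fun g : 𝒢.group => f g)
    ⟨h, cliffordGroup_le 𝒢 hh⟩

theorem continuous_gateCoeff (b a : Fin 4 × Fin 4) :
    Continuous fun G : Gate => gateCoeff (G : Matrix _ _ ℂ) b a := by
  unfold gateCoeff basisCoeff
  have h : Continuous fun G : Gate => (G : Matrix (Fin 2 × Fin 2) (Fin 2 × Fin 2) ℂ) :=
    continuous_subtype_val
  exact Complex.continuous_re.comp (continuous_const.mul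
    ((continuous_const.matrix_mul ((h.matrix_mul continuous_const).matrix_mul
      h.matrix_conjTranspose)).matrix_trace))

theorem gate_conjTranspose_mul (G : Gate) :
    (G : Matrix (Fin 2 × Fin 2) (Fin 2 × Fin 2) ℂ).conjTranspose * (G : Matrix _ _ ℂ) = 1 :=
  Matrix.mem_unitaryGroup_iff'.1 G.2

theorem gate_mul_conjTranspose (G : Gate) :
    (G : Matrix (Fin 2 × Fin 2) (Fin 2 × Fin 2) ℂ) * (G : Matrix _ _ ℂ).conjTranspose = 1 :=
  Matrix.mem_unitaryGroup_iff.1 G.2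

theorem gateCoeff_zero_right (G : Gate) (b : Fin 4 × Fin 4) :
    gateCoeff (G : Matrix _ _ ℂ) b 0 = if b = 0 then 1 else 0 :=
  pauli₂_isHermitianBasis.basisCoeff_of_eq_one (gate_mul_conjTranspose G) pauli₂_zero b

theorem gateCoeff_zero_left (G : Gate) (a : Fin 4 × Fin 4) :
    gateCoeff (G : Matrix _ _ ℂ) 0 a = if a = 0 then 1 else 0 := by
  rw [gateCoeff, ← pauli₂_isHermitianBasis.basisCoeff_conjTranspose]
  refine pauli₂_isHermitianBasis.basisCoeff_of_eq_one ?_ pauli₂_zero a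
  rw [Matrix.conjTranspose_conjTranspose]
  exact gate_conjTranspose_mul G

theorem sum_gateCoeff_sq (G : Gate) (a : Fin 4 × Fin 4) :
    ∑ b, gateCoeff (G : Matrix _ _ ℂ) b a ^ 2 = 1 :=
  pauli₂_isHermitianBasis.sum_basisCoeff_sq (gate_conjTranspose_mul G) a

theorem abs_gateCoeff_le (G : Gate) (b a : Fin 4 × Fin 4) :
    |gateCoeff (G : Matrix _ _ ℂ) b a| ≤ 1 := by
  rw [← sq_le_one_iff_abs_le_one, ← sum_gateCoeff_sq G a]
  exact Finset.single_le_sum (f := fun b => gateCoeff (G : Matrix _ _ ℂ) b a ^ 2)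
    (fun _ _ => sq_nonneg _) (Finset.mem_univ b)

theorem gateCoeff_mul_pauli (G h : Gate) (c : Fin 4 × Fin 4) (hh : (h : Matrix _ _ ℂ) = pauli₂ c)
    (b a : Fin 4 × Fin 4) : gateCoeff ((G * h : Gate) : Matrix _ _ ℂ) b a
      = pauliSign₂ a c * gateCoeff (G : Matrix _ _ ℂ) b a := by
  have e : ((G * h : Gate) : Matrix (Fin 2 × Fin 2) (Fin 2 × Fin 2) ℂ)
      = (G : Matrix _ _ ℂ) * pauli₂ c := by rw [← hh]; rfl
  have e2 : pauli₂ c * pauli₂ a * pauli₂ c = (pauliSign₂ a c : ℂ) • pauli₂ a := by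
    rw [Matrix.mul_assoc, pauli₂_comm a c, Matrix.mul_smul, ← Matrix.mul_assoc, pauli₂_mul_self,
      Matrix.one_mul]
  have key : ((gateCoeff ((G * h : Gate) : Matrix _ _ ℂ) b a : ℝ) : ℂ)
      = (pauliSign₂ a c : ℂ) * (gateCoeff (G : Matrix _ _ ℂ) b a : ℝ) := by
    rw [gateCoeff, gateCoeff, pauli₂_isHermitianBasis.coe_basisCoeff,
      pauli₂_isHermitianBasis.coe_basisCoeff, e, Matrix.conjTranspose_mul,
      pauli₂_isHermitianBasis.conjTranspose]
    have e3 : (G : Matrix (Fin 2 × Fin 2) (Fin 2 × Fin 2) ℂ) * pauli₂ c * pauli₂ a *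
        (pauli₂ c * (G : Matrix _ _ ℂ).conjTranspose)
        = (G : Matrix _ _ ℂ) * (pauli₂ c * pauli₂ a * pauli₂ c) *
          (G : Matrix _ _ ℂ).conjTranspose := by
      simp only [Matrix.mul_assoc]
    rw [e3, e2, Matrix.mul_smul, Matrix.smul_mul, Matrix.mul_smul, Matrix.trace_smul, smul_eq_mul]
    ring
  exact_mod_cast key

theorem gateCoeff_swap_mul (G h : Gate) {b b' : Fin 4 × Fin 4}
    (hh : (h : Matrix _ _ ℂ).conjTranspose * pauli₂ b * (h : Matrix _ _ ℂ) = pauli₂ b')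
    (a : Fin 4 × Fin 4) :
    gateCoeff ((h * G : Gate) : Matrix _ _ ℂ) b a = gateCoeff (G : Matrix _ _ ℂ) b' a := by
  have e : ((h * G : Gate) : Matrix (Fin 2 × Fin 2) (Fin 2 × Fin 2) ℂ)
      = (h : Matrix _ _ ℂ) * (G : Matrix _ _ ℂ) := rfl
  rw [gateCoeff, gateCoeff, basisCoeff, basisCoeff, ← hh, e, Matrix.conjTranspose_mul]
  have e3 : pauli₂ b * ((h : Matrix _ _ ℂ) * (G : Matrix _ _ ℂ) * pauli₂ a *
      ((G : Matrix _ _ ℂ).conjTranspose * (h : Matrix _ _ ℂ).conjTranspose))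
      = (pauli₂ b * (h : Matrix _ _ ℂ) * ((G : Matrix _ _ ℂ) * pauli₂ a *
        (G : Matrix _ _ ℂ).conjTranspose)) * (h : Matrix _ _ ℂ).conjTranspose := by
    simp only [Matrix.mul_assoc]
  rw [e3, Matrix.trace_mul_comm]
  simp only [Matrix.mul_assoc]

/-- The second moments of the coefficients of a random gate. -/
def pairWeight (b a : Fin 4 × Fin 4) : ℝ :=
  if a = 0 then (if b = 0 then 1 else 0) else if b = 0 then 0 else 1 / 15

theorem integrable_gateCoeff_mul (𝒢 : GateModel) (b a a' : Fin 4 × Fin 4) :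
    Integrable (fun G : Gate => gateCoeff (G : Matrix _ _ ℂ) b a *
      gateCoeff (G : Matrix _ _ ℂ) b a') 𝒢.law := by
  refine Integrable.of_bound
    ((continuous_gateCoeff b a).mul (continuous_gateCoeff b a')).aestronglyMeasurable 1
    (ae_of_all _ fun G => ?_)
  rw [norm_mul, Real.norm_eq_abs, Real.norm_eq_abs]
  exact mul_le_one₀ (abs_gateCoeff_le G b a) (abs_nonneg _) (abs_gateCoeff_le G b a')

theorem integral_gateCoeff_cross (𝒢 : GateModel) (b : Fin 4 × Fin 4) {a a' : Fin 4 × Fin 4}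
    (h : a ≠ a') : ∫ G : Gate, gateCoeff (G : Matrix _ _ ℂ) b a *
      gateCoeff (G : Matrix _ _ ℂ) b a' ∂𝒢.law = 0 := by
  obtain ⟨c, hc⟩ := exists_pauliSign₂_ne a a' h
  obtain ⟨g, hg, hgc⟩ := exists_pauliGate c
  have h1 := integral_law_mul_right 𝒢 (f := fun G => gateCoeff (G : Matrix _ _ ℂ) b a *
    gateCoeff (G : Matrix _ _ ℂ) b a') ((continuous_gateCoeff b a).mul (continuous_gateCoeff b a')) hg
  have hc' : (pauliSign₂ a c : ℝ) * pauliSign₂ a' c = -1 := by exact_mod_cast hc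
  have h2 : ∀ G : Gate, gateCoeff ((G * g : Gate) : Matrix _ _ ℂ) b a *
      gateCoeff ((G * g : Gate) : Matrix _ _ ℂ) b a'
      = -(gateCoeff (G : Matrix _ _ ℂ) b a * gateCoeff (G : Matrix _ _ ℂ) b a') := by
    intro G
    rw [gateCoeff_mul_pauli G g c hgc, gateCoeff_mul_pauli G g c hgc, mul_mul_mul_comm, hc',
      neg_one_mul]
  simp only [h2] at h1
  rw [integral_neg] at h1
  linarith

theorem integral_gateCoeff_sq_eq (𝒢 : GateModel) (a : Fin 4 × Fin 4) {b b' : Fin 4 × Fin 4}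
    (h : pauliSign₂ b b' = -1) : ∫ G : Gate, gateCoeff (G : Matrix _ _ ℂ) b a ^ 2 ∂𝒢.law
      = ∫ G : Gate, gateCoeff (G : Matrix _ _ ℂ) b' a ^ 2 ∂𝒢.law := by
  obtain ⟨g, hg, hgc⟩ := exists_swapGate h
  rw [← integral_law_mul_left 𝒢 (f := fun G => gateCoeff (G : Matrix _ _ ℂ) b a ^ 2)
    ((continuous_gateCoeff b a).pow 2) hg]
  simp only [gateCoeff_swap_mul _ g hgc]

theorem integral_gateCoeff_sq (𝒢 : GateModel) {a b : Fin 4 × Fin 4} (ha : a ≠ 0) (hb : b ≠ 0) :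
    ∫ G : Gate, gateCoeff (G : Matrix _ _ ℂ) b a ^ 2 ∂𝒢.law = 1 / 15 := by
  have h1 : ∑ b', ∫ G : Gate, gateCoeff (G : Matrix _ _ ℂ) b' a ^ 2 ∂𝒢.law = 1 := by
    rw [← integral_finsetSum]
    · simp only [sum_gateCoeff_sq]
      simp
    · intro b' _
      simpa only [sq] using integrable_gateCoeff_mul 𝒢 b' a a
  have h2 : ∀ b' ∈ Finset.univ.erase (0 : Fin 4 × Fin 4),
      ∫ G : Gate, gateCoeff (G : Matrix _ _ ℂ) b' a ^ 2 ∂𝒢.law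
        = ∫ G : Gate, gateCoeff (G : Matrix _ _ ℂ) b a ^ 2 ∂𝒢.law := by
    intro b' hb'
    obtain ⟨c, hc, hc'⟩ := exists_pauliSign₂_eq_neg_one b' b (Finset.ne_of_mem_erase hb') hb
    rw [integral_gateCoeff_sq_eq 𝒢 a hc, integral_gateCoeff_sq_eq 𝒢 a hc']
  rw [← Finset.add_sum_erase _ _ (Finset.mem_univ 0), Finset.sum_congr rfl h2] at h1
  simp only [gateCoeff_zero_left, if_neg ha] at h1
  simp only [Finset.sum_const, Finset.card_erase_of_mem (Finset.mem_univ _), Finset.card_univ,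
    Fintype.card_prod, Fintype.card_fin] at h1
  norm_num at h1
  linarith

theorem integral_gateCoeff_mul (𝒢 : GateModel) (b a a' : Fin 4 × Fin 4) :
    ∫ G : Gate, gateCoeff (G : Matrix _ _ ℂ) b a * gateCoeff (G : Matrix _ _ ℂ) b a' ∂𝒢.law
      = if a = a' then pairWeight b a else 0 := by
  split_ifs with h
  swap
  · exact integral_gateCoeff_cross 𝒢 b h
  subst h
  unfold pairWeight
  by_cases ha : a = 0
  · subst ha
    simp only [gateCoeff_zero_right, if_true]
    by_cases hb : b = 0 <;> simp [hb]
  · rw [if_neg ha]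
    by_cases hb : b = 0
    · subst hb
      simp [gateCoeff_zero_left, ha]
    · rw [if_neg hb, ← integral_gateCoeff_sq 𝒢 ha hb]
      simp only [sq]

end GateMoments

/-! ### Second moments of random layers and circuits -/

section Layers

variable {n : ℕ}

theorem integral_uniformOn_matching (F : Matching n → ℝ) :
    ∫ σ, F σ ∂(uniformOn (Set.univ : Set (Matching n))) = matchingAvg F := by
  have : IsProbabilityMeasure (uniformOn (Set.univ : Set (Matching n))) :=
    isProbabilityMeasure_uniformOn Set.finite_univ Set.univ_nonempty
  rw [integral_fintype Integrable.of_finite, matchingAvg, Finset.sum_div]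
  refine Finset.sum_congr rfl fun σ _ => ?_
  rw [Measure.real, uniformOn_univ, Measure.count_singleton, ENNReal.toReal_div, smul_eq_mul]
  simp [div_eq_inv_mul]

/-- The coefficient of a layer as a function of the matching and the gates. -/
theorem measurable_pauliCoeff_layerMatrix (b a : Fin n → Fin 4) :
    Measurable fun L : Layer n => pauliCoeff (layerMatrix L) b a := by
  simp only [pauliCoeff_layerMatrix]
  refine measurable_from_prod_countable_right fun σ => ?_
  have h : Measurable fun G : Fin n → Gate => ∏ i with i < σ.1 i,
      gateCoeff (G i : Matrix _ _ ℂ) (b i, b (σ.1 i)) (a i, a (σ.1 i)) :=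
    Finset.measurable_prod _ fun i _ =>
      (continuous_gateCoeff _ _).measurable.comp (measurable_pi_apply i)
  exact h.mul_const (∏ i with σ.1 i = i, if b i = a i then 1 else 0)

theorem abs_pauliCoeff_le {ι : Type} [Fintype ι] [DecidableEq ι] {U : Matrix (Bits ι) (Bits ι) ℂ}
    (hU : U.conjTranspose * U = 1) (b a : ι → Fin 4) : |pauliCoeff U b a| ≤ 1 := by
  rw [← sq_le_one_iff_abs_le_one, ← pauliString_isHermitianBasis.sum_basisCoeff_sq hU a]
  exact Finset.single_le_sum (f := fun b => pauliCoeff U b a ^ 2)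
    (fun _ _ => sq_nonneg _) (Finset.mem_univ b)

theorem layerMatrix_conjTranspose_mul (L : Layer n) :
    (layerMatrix L).conjTranspose * layerMatrix L = 1 :=
  mul_eq_one_comm.1 (layerMatrix_mul_conjTranspose L)

theorem integrable_pauliCoeff_layerMatrix_mul (𝒢 : GateModel) (b a a' : Fin n → Fin 4) :
    Integrable (fun L : Layer n => pauliCoeff (layerMatrix L) b a * pauliCoeff (layerMatrix L) b a')
      (layerLaw 𝒢 n) := by
  refine Integrable.of_bound ((measurable_pauliCoeff_layerMatrix b a).mul
    (measurable_pauliCoeff_layerMatrix b a')).aestronglyMeasurable 1 (ae_of_all _ fun L => ?_)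
  rw [norm_mul, Real.norm_eq_abs, Real.norm_eq_abs]
  exact mul_le_one₀ (abs_pauliCoeff_le (layerMatrix_conjTranspose_mul L) b a) (abs_nonneg _)
    (abs_pauliCoeff_le (layerMatrix_conjTranspose_mul L) b a')

/-- The second moments of the coefficients of a random layer with a given matching. -/
def matchingWeight (σ : Matching n) (b a : Fin n → Fin 4) : ℝ :=
  (∏ i with i < σ.1 i, pairWeight (b i, b (σ.1 i)) (a i, a (σ.1 i))) *
    ∏ i with σ.1 i = i, if b i = a i then 1 else 0

theorem integral_pauliCoeff_gates (𝒢 : GateModel) (σ : Matching n) (b a a' : Fin n → Fin 4) :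
    ∫ G : Fin n → Gate, pauliCoeff (layerMatrix (σ, G)) b a * pauliCoeff (layerMatrix (σ, G)) b a'
      ∂(Measure.pi fun _ => 𝒢.law) = if a = a' then matchingWeight σ b a else 0 := by
  have h1 : ∀ G : Fin n → Gate,
      pauliCoeff (layerMatrix (σ, G)) b a * pauliCoeff (layerMatrix (σ, G)) b a'
      = (∏ i, if i < σ.1 i then gateCoeff (G i : Matrix _ _ ℂ) (b i, b (σ.1 i)) (a i, a (σ.1 i)) *
          gateCoeff (G i : Matrix _ _ ℂ) (b i, b (σ.1 i)) (a' i, a' (σ.1 i)) else 1) *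
        ∏ i with σ.1 i = i, (if b i = a i then 1 else 0) * (if b i = a' i then 1 else 0) := by
    intro G
    rw [pauliCoeff_layerMatrix, pauliCoeff_layerMatrix, mul_mul_mul_comm,
      ← Finset.prod_mul_distrib, ← Finset.prod_mul_distrib, ← Finset.prod_filter]
  simp only [h1]
  rw [integral_mul_const, integral_fintype_prod_eq_prod (fun i (g : Gate) => if i < σ.1 i then
    gateCoeff (g : Matrix _ _ ℂ) (b i, b (σ.1 i)) (a i, a (σ.1 i)) *
      gateCoeff (g : Matrix _ _ ℂ) (b i, b (σ.1 i)) (a' i, a' (σ.1 i)) else 1)]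
  have h2 : ∀ i, ∫ g : Gate, (if i < σ.1 i then
      gateCoeff (g : Matrix _ _ ℂ) (b i, b (σ.1 i)) (a i, a (σ.1 i)) *
        gateCoeff (g : Matrix _ _ ℂ) (b i, b (σ.1 i)) (a' i, a' (σ.1 i)) else 1) ∂𝒢.law
      = if i < σ.1 i then (if (a i, a (σ.1 i)) = (a' i, a' (σ.1 i)) then
          pairWeight (b i, b (σ.1 i)) (a i, a (σ.1 i)) else 0) else 1 := by
    intro i
    by_cases h : i < σ.1 i
    · simp only [h, if_true]
      exact integral_gateCoeff_mul 𝒢 _ _ _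
    · simp [h]
  simp only [h2]
  rw [← Finset.prod_filter]
  split_ifs with h
  · subst h
    have h3 : ∀ i, (if b i = a i then (1 : ℝ) else 0) * (if b i = a i then 1 else 0)
        = if b i = a i then 1 else 0 := by
      intro i
      split_ifs <;> norm_num
    simp only [h3, if_true]
    rfl
  · obtain ⟨j, hj⟩ := Function.ne_iff.1 h
    rcases lt_trichotomy j (σ.1 j) with hlt | heq | hgt
    · rw [Finset.prod_eq_zero (i := j) (by simpa using hlt), zero_mul]
      rw [if_neg]
      simp [hj]
    · rw [mul_comm, Finset.prod_eq_zero (i := j) (by simpa using heq.symm), zero_mul]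
      by_cases h3 : b j = a j
      · simp [h3, hj]
      · simp [h3]
    · rw [Finset.prod_eq_zero (i := σ.1 j) (by simpa [σ.2.1] using hgt), zero_mul]
      rw [if_neg]
      simp [σ.2.1, hj]

/-- The second moments of the coefficients of a random layer. -/
def layerWeight (b a : Fin n → Fin 4) : ℝ := matchingAvg fun σ => matchingWeight σ b a

theorem integral_pauliCoeff_layer (𝒢 : GateModel) (b a a' : Fin n → Fin 4) :
    ∫ L : Layer n, pauliCoeff (layerMatrix L) b a * pauliCoeff (layerMatrix L) b a'
      ∂(layerLaw 𝒢 n) = if a = a' then layerWeight b a else 0 := by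
  have : IsProbabilityMeasure (uniformOn (Set.univ : Set (Matching n))) :=
    isProbabilityMeasure_uniformOn Set.finite_univ Set.univ_nonempty
  have h1 := integrable_pauliCoeff_layerMatrix_mul 𝒢 b a a'
  unfold layerLaw at h1 ⊢
  rw [integral_prod _ h1]
  simp only [integral_pauliCoeff_gates]
  rw [integral_uniformOn_matching]
  split_ifs
  · rfl
  · exact matchingAvg_const 0

/-- The support of a Pauli string. -/
def support {ι : Type} [Fintype ι] (a : ι → Fin 4) : Finset ι := Finset.univ.filter fun i => a i ≠ 0

theorem mem_support {ι : Type} [Fintype ι] {a : ι → Fin 4} {i : ι} : i ∈ support a ↔ a i ≠ 0 := by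
  simp [support]

theorem sum_pairWeight (a b : Fin 4) (p q : Prop) [Decidable p] [Decidable q] :
    ∑ c, ∑ d, (if (c ≠ 0 ↔ p) then (1 : ℝ) else 0) * (if (d ≠ 0 ↔ q) then 1 else 0) *
      pairWeight (c, d) (a, b) = pairProb (a ≠ 0 ∨ b ≠ 0) p q := by
  by_cases ha : a = 0 <;> by_cases hb : b = 0 <;> by_cases hp : p <;> by_cases hq : q <;>
    simp [Fin.sum_univ_four, pairWeight, pairProb, ha, hb, hp, hq, Prod.ext_iff] <;> norm_num

theorem sum_matchingWeight (σ : Matching n) (a : Fin n → Fin 4) (S : Finset (Fin n)) :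
    ∑ b, (if support b = S then matchingWeight σ b a else 0) = stepProb σ (support a) S := by
  have e : ∀ b : Fin n → Fin 4, (if support b = S then matchingWeight σ b a else 0)
      = (∏ i with i < σ.1 i, (if (b i ≠ 0 ↔ i ∈ S) then (1 : ℝ) else 0) *
          (if (b (σ.1 i) ≠ 0 ↔ σ.1 i ∈ S) then 1 else 0) *
          pairWeight (b i, b (σ.1 i)) (a i, a (σ.1 i))) *
        ∏ i with σ.1 i = i, (if (b i ≠ 0 ↔ i ∈ S) then (1 : ℝ) else 0) *
          if b i = a i then 1 else 0 := by
    intro b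
    have h1 := prod_matching σ fun i => if (b i ≠ 0 ↔ i ∈ S) then (1 : ℝ) else 0
    have h2 : (if support b = S then (1 : ℝ) else 0)
        = ∏ i, if (b i ≠ 0 ↔ i ∈ S) then (1 : ℝ) else 0 := by
      rw [Finset.prod_ite_zero]
      simp [Finset.ext_iff, mem_support]
    have h3 : (if support b = S then matchingWeight σ b a else 0)
        = (if support b = S then 1 else 0) * matchingWeight σ b a := by split_ifs <;> simp
    rw [h3, h2, h1, matchingWeight, mul_mul_mul_comm, ← Finset.prod_mul_distrib,
      ← Finset.prod_mul_distrib]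
  simp only [e]
  have := sum_prod_matching σ
    (fun i c d => (if (c ≠ 0 ↔ i ∈ S) then (1 : ℝ) else 0) *
          (if (d ≠ 0 ↔ σ.1 i ∈ S) then 1 else 0) * pairWeight (c, d) (a i, a (σ.1 i)))
    (fun i c => (if (c ≠ 0 ↔ i ∈ S) then (1 : ℝ) else 0) * if c = a i then 1 else 0)
  rw [this, stepProb]
  congr 1
  · refine Finset.prod_congr rfl fun i _ => ?_
    rw [sum_pairWeight]
    simp only [mem_support]
  · refine Finset.prod_congr rfl fun i _ => ?_
    simp [mem_support]

theorem sum_layerWeight (a : Fin n → Fin 4) (S : Finset (Fin n)) :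
    ∑ b, (if support b = S then layerWeight b a else 0) = supportChain n (support a) S := by
  rw [supportChain_eq]
  simp only [← sum_matchingWeight]
  rw [matchingAvg_sum]
  refine Finset.sum_congr rfl fun b _ => ?_
  split_ifs
  · rfl
  · exact (matchingAvg_const 0).symm

theorem measurable_pauliCoeff_circuitMatrix {t : ℕ} (b a : Fin n → Fin 4) :
    Measurable fun w : Fin t → Layer n => pauliCoeff (circuitMatrix w) b a := by
  induction t generalizing b with
  | zero =>
    simp only [circuitMatrix]
    exact measurable_const
  | succ t ih =>
    simp only [circuitMatrix, pauliCoeff, pauliString_isHermitianBasis.basisCoeff_mul]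
    refine Finset.measurable_sum _ fun c _ => ?_
    have h1 : Measurable fun w : Fin (t + 1) → Layer n =>
        pauliCoeff (layerMatrix (w (Fin.last t))) b c :=
      (measurable_pauliCoeff_layerMatrix b c).comp (measurable_pi_apply _)
    have h2 : Measurable fun w : Fin (t + 1) → Layer n =>
        pauliCoeff (circuitMatrix fun s : Fin t => w s.castSucc) c a :=
      (ih c).comp (measurable_pi_lambda _ fun s => measurable_pi_apply _)
    exact h1.mul h2

theorem integrable_pauliCoeff_circuitMatrix_mul (𝒢 : GateModel) (t : ℕ) (b b' a : Fin n → Fin 4) :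
    Integrable (fun w : Fin t → Layer n => pauliCoeff (circuitMatrix w) b a *
      pauliCoeff (circuitMatrix w) b' a) (circuitLaw 𝒢 n t) := by
  refine Integrable.of_bound ((measurable_pauliCoeff_circuitMatrix b a).mul
    (measurable_pauliCoeff_circuitMatrix b' a)).aestronglyMeasurable 1 (ae_of_all _ fun w => ?_)
  rw [norm_mul, Real.norm_eq_abs, Real.norm_eq_abs]
  exact mul_le_one₀ (abs_pauliCoeff_le (circuitMatrix_conjTranspose_mul w) b a) (abs_nonneg _)
    (abs_pauliCoeff_le (circuitMatrix_conjTranspose_mul w) b' a)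

/-- The mean squared coefficients evolve by the layer weights. -/
theorem integral_pauliCoeff_sq_succ (𝒢 : GateModel) (t : ℕ) (b a : Fin n → Fin 4) :
    ∫ w, pauliCoeff (circuitMatrix w) b a ^ 2 ∂(circuitLaw 𝒢 n (t + 1))
      = ∑ c, layerWeight b c * ∫ w, pauliCoeff (circuitMatrix w) c a ^ 2 ∂(circuitLaw 𝒢 n t) := by
  have hmp := measurePreserving_piFinSuccAbove (n := t) (fun _ : Fin (t + 1) => layerLaw 𝒢 n)
    (Fin.last t)
  let F : Layer n × (Fin t → Layer n) → ℝ := fun p => ∑ c, ∑ c',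
    pauliCoeff (layerMatrix p.1) b c * pauliCoeff (layerMatrix p.1) b c' *
      (pauliCoeff (circuitMatrix p.2) c a * pauliCoeff (circuitMatrix p.2) c' a)
  have h1 : ∀ w : Fin (t + 1) → Layer n, pauliCoeff (circuitMatrix w) b a ^ 2
      = F (MeasurableEquiv.piFinSuccAbove (fun _ => Layer n) (Fin.last t) w) := by
    intro w
    have e : circuitMatrix w = layerMatrix (w (Fin.last t)) *
      circuitMatrix (fun s : Fin t => w s.castSucc) := rfl
    rw [e, sq, pauliCoeff, pauliString_isHermitianBasis.basisCoeff_mul, Finset.sum_mul_sum]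
    refine Finset.sum_congr rfl fun c _ => Finset.sum_congr rfl fun c' _ => ?_
    have e2 : (MeasurableEquiv.piFinSuccAbove (fun _ => Layer n) (Fin.last t) w)
        = (w (Fin.last t), fun s : Fin t => w s.castSucc) := by
      refine Prod.ext rfl ?_
      funext s
      change w ((Fin.last t).succAbove s) = _
      rw [Fin.succAbove_last]
    rw [e2, mul_mul_mul_comm]
  simp only [h1]
  unfold circuitLaw
  refine (hmp.integral_comp (MeasurableEquiv.measurableEmbedding _) F).trans ?_
  have hint : ∀ c c', Integrable (fun p : Layer n × (Fin t → Layer n) =>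
      pauliCoeff (layerMatrix p.1) b c * pauliCoeff (layerMatrix p.1) b c' *
        (pauliCoeff (circuitMatrix p.2) c a * pauliCoeff (circuitMatrix p.2) c' a))
      ((layerLaw 𝒢 n).prod (Measure.pi fun _ => layerLaw 𝒢 n)) := fun c c' =>
    (integrable_pauliCoeff_layerMatrix_mul 𝒢 b c c').mul_prod
      (integrable_pauliCoeff_circuitMatrix_mul 𝒢 t c c' a)
  rw [integral_finsetSum _ fun c _ => integrable_finsetSum _ fun c' _ => hint c c']
  refine Finset.sum_congr rfl fun c _ => ?_
  rw [integral_finsetSum _ fun c' _ => hint c c', Finset.sum_eq_single c]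
  · rw [integral_prod_mul (fun L => pauliCoeff (layerMatrix L) b c * pauliCoeff (layerMatrix L) b c)
      (fun w => pauliCoeff (circuitMatrix w) c a * pauliCoeff (circuitMatrix w) c a),
      integral_pauliCoeff_layer, if_pos rfl]
    simp only [sq]
  · intro c' _ hc
    rw [integral_prod_mul (fun L => pauliCoeff (layerMatrix L) b c * pauliCoeff (layerMatrix L) b c')
      (fun w => pauliCoeff (circuitMatrix w) c a * pauliCoeff (circuitMatrix w) c' a),
      integral_pauliCoeff_layer, if_neg hc.symm, zero_mul]
  · simp

/-- The mean squared coefficients of a random circuit, summed over the strings with a given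
support, are the transition probabilities of the support chain. -/
theorem sum_integral_pauliCoeff_sq (𝒢 : GateModel) (t : ℕ) (a : Fin n → Fin 4)
    (S : Finset (Fin n)) :
    ∑ b, (if support b = S then ∫ w, pauliCoeff (circuitMatrix w) b a ^ 2 ∂(circuitLaw 𝒢 n t)
      else 0) = (supportChain n ^ t) (support a) S := by
  induction t generalizing S with
  | zero =>
    have h : ∀ b, ∫ w : Fin 0 → Layer n, pauliCoeff (circuitMatrix w) b a ^ 2 ∂(circuitLaw 𝒢 n 0)
        = if b = a then 1 else 0 := by
      intro b
      simp only [circuitMatrix, pauliCoeff, pauliString_isHermitianBasis.basisCoeff_one]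
      split_ifs <;> simp
    simp only [h]
    rw [pow_zero, Matrix.one_apply, Finset.sum_eq_single a]
    · simp
    · intro b _ hb
      simp [hb]
    · simp
  | succ t ih =>
    simp only [integral_pauliCoeff_sq_succ]
    rw [pow_succ, Matrix.mul_apply]
    calc _ = ∑ b, ∑ c, (if support b = S then layerWeight b c else 0) *
          ∫ w, pauliCoeff (circuitMatrix w) c a ^ 2 ∂(circuitLaw 𝒢 n t) := by
          refine Finset.sum_congr rfl fun b _ => ?_
          split_ifs <;> simp
      _ = ∑ c, supportChain n (support c) S *
          ∫ w, pauliCoeff (circuitMatrix w) c a ^ 2 ∂(circuitLaw 𝒢 n t) := by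
          rw [Finset.sum_comm]
          simp only [← Finset.sum_mul, sum_layerWeight]
      _ = ∑ c, ∑ T, (if support c = T then ∫ w, pauliCoeff (circuitMatrix w) c a ^ 2
          ∂(circuitLaw 𝒢 n t) else 0) * supportChain n T S := by
          refine Finset.sum_congr rfl fun c _ => ?_
          simp only [ite_mul, zero_mul]
          rw [Finset.sum_ite_eq, if_pos (Finset.mem_univ _), mul_comm]
      _ = _ := by
          rw [Finset.sum_comm]
          simp only [← Finset.sum_mul, ih]

end Layers

/-! ### The distance of the reduced output state from the maximally mixed state -/

section Distance

open scoped ComplexOrder in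
theorem traceNorm_sq_le {ι : Type} [Fintype ι] [DecidableEq ι] (X : Matrix ι ι ℂ) :
    traceNorm X ^ 2 ≤ Fintype.card ι * ∑ k : ι × ι, ‖X k.1 k.2‖ ^ 2 := by
  have hX := Matrix.isHermitian_conjTranspose_mul_self X
  have hpos : ∀ i, 0 ≤ hX.eigenvalues i :=
    (Matrix.posSemidef_conjTranspose_mul_self X).eigenvalues_nonneg
  have h1 : ((∑ i, hX.eigenvalues i : ℝ) : ℂ) = ((∑ k : ι × ι, ‖X k.1 k.2‖ ^ 2 : ℝ) : ℂ) := by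
    push_cast
    refine Eq.trans hX.trace_eq_sum_eigenvalues.symm ?_
    rw [Matrix.trace, Fintype.sum_prod_type, Finset.sum_comm]
    refine Finset.sum_congr rfl fun i _ => ?_
    rw [Matrix.diag_apply, Matrix.mul_apply]
    refine Finset.sum_congr rfl fun j _ => ?_
    rw [Matrix.conjTranspose_apply, ← Complex.conj_mul']
    rfl
  have h2 : ∑ i, hX.eigenvalues i = ∑ k : ι × ι, ‖X k.1 k.2‖ ^ 2 := by exact_mod_cast h1
  rw [← h2, traceNorm]
  refine (sq_sum_le_card_mul_sum_sq).trans_eq ?_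
  simp only [Real.sq_sqrt (hpos _), Finset.card_univ]

/-- Parseval's identity for a finite orthogonal basis. -/
theorem sum_norm_sq_eq {J K : Type*} [Fintype J] [Fintype K] [DecidableEq K] (e : J → K → ℂ)
    (D : ℝ) (he : ∀ k k', ∑ j, e j k * star (e j k') = if k = k' then (D : ℂ) else 0)
    (X : K → ℂ) : ∑ j, ‖∑ k, e j k * X k‖ ^ 2 = D * ∑ k, ‖X k‖ ^ 2 := by
  have h1 : ∀ z : ℂ, ((‖z‖ : ℂ)) ^ 2 = z * star z := fun z => (Complex.mul_conj' z).symm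
  have key : ((∑ j, ‖∑ k, e j k * X k‖ ^ 2 : ℝ) : ℂ) = ((D * ∑ k, ‖X k‖ ^ 2 : ℝ) : ℂ) := by
    push_cast
    simp only [h1, star_sum, star_mul', Finset.sum_mul_sum]
    rw [Finset.sum_comm, Finset.mul_sum]
    refine Finset.sum_congr rfl fun k _ => ?_
    rw [Finset.sum_comm]
    have h2 : ∀ k' j, e j k * X k * (star (e j k') * star (X k'))
        = e j k * star (e j k') * (X k * star (X k')) := fun k' j => by ring
    simp only [h2, ← Finset.sum_mul, he, ite_mul, zero_mul]
    rw [Finset.sum_ite_eq, if_pos (Finset.mem_univ _)]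
  exact_mod_cast key

variable {n : ℕ}

/-- Bit strings are pairs of a bit string on a set and one on its complement. -/
def glueEquiv (T : Finset (Fin n)) : Bits T × Bits (Tᶜ : Finset (Fin n)) ≃ Bits (Fin n) where
  toFun p := glue T p.1 p.2
  invFun y := (fun i => y i, fun i => y i)
  left_inv p := by
    refine Prod.ext ?_ ?_
    · funext i
      simp [glue, i.2]
    · funext i
      have := Finset.mem_compl.1 i.2
      simp [glue, this]
  right_inv y := by
    funext i
    simp [glue]

theorem sum_bits_eq (T : Finset (Fin n)) (f : Bits (Fin n) → ℂ) :
    ∑ z, f z = ∑ s, ∑ q, f (glue T s q) := by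
  rw [← (glueEquiv T).sum_comp, Fintype.sum_prod_type]
  rfl

theorem glue_of_mem (T : Finset (Fin n)) (s : Bits T) (q : Bits (Tᶜ : Finset (Fin n))) (i : T) :
    glue T s q i = s i := by
  simp [glue, i.2]

theorem glue_of_mem_compl (T : Finset (Fin n)) (s : Bits T) (q : Bits (Tᶜ : Finset (Fin n)))
    (i : (Tᶜ : Finset (Fin n))) : glue T s q i = q i := by
  have := Finset.mem_compl.1 i.2
  simp [glue, this]

/-- A Pauli string on a set of qubits, extended by identities. -/
def extend (T : Finset (Fin n)) (r : T → Fin 4) : Fin n → Fin 4 := fun i =>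
  if h : i ∈ T then r ⟨i, h⟩ else 0

theorem pauliString_extend (T : Finset (Fin n)) (r : T → Fin 4) (s s' : Bits T)
    (q q' : Bits (Tᶜ : Finset (Fin n))) :
    pauliString (extend T r) (glue T s q) (glue T s' q')
      = pauliString r s s' * if q = q' then 1 else 0 := by
  rw [pauliString, ← Finset.prod_mul_prod_compl T, ← Finset.prod_coe_sort T,
    ← Finset.prod_coe_sort Tᶜ]
  simp only [glue_of_mem, glue_of_mem_compl]
  congr 1
  · refine Finset.prod_congr rfl fun i _ => ?_
    simp [extend, i.2]
  · have h : ∀ i : (Tᶜ : Finset (Fin n)), pauli (extend T r i) (q i) (q' i)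
        = if q i = q' i then 1 else 0 := by
      intro i
      have := Finset.mem_compl.1 i.2
      simp [extend, this, pauli, Matrix.one_apply]
    simp only [h]
    rw [Finset.prod_ite_zero]
    simp [funext_iff]

theorem extend_zero (T : Finset (Fin n)) : extend T (fun _ => 0) = fun _ => 0 := by
  funext i
  simp [extend]

theorem extend_injective (T : Finset (Fin n)) : Function.Injective (extend T) := by
  intro r r' h
  funext i
  have := congrFun h i
  simpa [extend, i.2] using this

theorem support_extend_subset (T : Finset (Fin n)) (r : T → Fin 4) : support (extend T r) ⊆ T := by
  intro i hi
  by_contra h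
  rw [mem_support] at hi
  simp [extend, h] at hi

/-- The normalization of the maximally entangled states. -/
def entangledNorm (Q : Finset (Fin n)) : ℂ :=
  ((Real.sqrt (2 ^ Fintype.card Q) : ℝ) : ℂ)⁻¹ *
    ((Real.sqrt (2 ^ Fintype.card (Qᶜ : Finset (Fin n))) : ℝ) : ℂ)⁻¹

theorem entangledNorm_mul_star (Q : Finset (Fin n)) :
    entangledNorm Q * star (entangledNorm Q) = ((2 : ℂ) ^ Fintype.card (Fin n))⁻¹ := by
  have h : star (entangledNorm Q) = entangledNorm Q := by
    unfold entangledNorm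
    rw [← Complex.ofReal_inv, ← Complex.ofReal_inv, ← Complex.ofReal_mul]
    exact Complex.conj_ofReal _
  rw [h, entangledNorm, mul_mul_mul_comm, ← mul_inv, ← mul_inv, ← Complex.ofReal_mul,
    ← Complex.ofReal_mul, Real.mul_self_sqrt (by positivity), Real.mul_self_sqrt (by positivity),
    ← mul_inv]
  congr 1
  push_cast
  rw [← pow_add, Fintype.card_coe, Fintype.card_coe, Finset.card_add_card_compl]

theorem outputState_eq (Q : Finset (Fin n)) (U : Matrix (Bits (Fin n)) (Bits (Fin n)) ℂ)
    (x : Bits Q) (a : Bits (Qᶜ : Finset (Fin n))) (z : Bits (Fin n)) :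
    outputState Q U ((x, a), z) = entangledNorm Q * U z (glue Q x a) := by
  rw [outputState, sum_bits_eq Q, Finset.sum_eq_single x, Finset.sum_eq_single a]
  · simp [initialState, maxEntangled, glue_of_mem, glue_of_mem_compl, entangledNorm]
    ring
  · intro a' _ ha
    simp only [initialState, maxEntangled, glue_of_mem, glue_of_mem_compl]
    rw [if_neg (Ne.symm ha : ¬ a = a')]
    simp
  · simp
  · intro x' _ hx
    refine Finset.sum_eq_zero fun a' _ => ?_
    simp only [initialState, maxEntangled, glue_of_mem, glue_of_mem_compl]
    rw [if_neg (Ne.symm hx : ¬ x = x')]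
    simp
  · simp

theorem sum_permute {A B C D E G : Type*} [Fintype A] [Fintype B] [Fintype C] [Fintype D]
    [Fintype E] [Fintype G] (F : A → B → C → D → E → G → ℂ) :
    ∑ x, ∑ s, ∑ y, ∑ s', ∑ a, ∑ q, F x s y s' a q
      = ∑ s', ∑ q, ∑ s, ∑ y, ∑ a, ∑ x, F x s y s' a q := by
  have h1 : ∑ x, ∑ s, ∑ y, ∑ s', ∑ a, ∑ q, F x s y s' a q
      = ∑ p : A × B × C × D × E × G, F p.1 p.2.1 p.2.2.1 p.2.2.2.1 p.2.2.2.2.1 p.2.2.2.2.2 := by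
    simp only [Fintype.sum_prod_type]
  have h2 : ∑ s', ∑ q, ∑ s, ∑ y, ∑ a, ∑ x, F x s y s' a q
      = ∑ p : D × G × B × C × E × A,
        F p.2.2.2.2.2 p.2.2.1 p.2.2.2.1 p.1 p.2.2.2.2.1 p.2.1 := by
    simp only [Fintype.sum_prod_type]
  rw [h1, h2]
  exact Fintype.sum_equiv
    ⟨fun p => (p.2.2.2.1, p.2.2.2.2.2, p.2.1, p.2.2.1, p.2.2.2.2.1, p.1),
      fun p => (p.2.2.2.2.2, p.2.2.1, p.2.2.2.1, p.1, p.2.2.2.2.1, p.2.1),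
      fun _ => rfl, fun _ => rfl⟩ _ _ fun _ => rfl

/-- The matrix elements of the tensor product basis of Pauli strings on two systems. -/
def jointPauli (Q T : Finset (Fin n)) (j : (Q → Fin 4) × (T → Fin 4))
    (k : (Bits Q × Bits T) × (Bits Q × Bits T)) : ℂ :=
  pauliString j.1 k.1.1 k.2.1 * pauliString j.2 k.2.2 k.1.2

theorem sum_jointPauli_mul_star (Q T : Finset (Fin n))
    (k k' : (Bits Q × Bits T) × (Bits Q × Bits T)) :
    ∑ j, jointPauli Q T j k * star (jointPauli Q T j k')
      = if k = k' then ((2 ^ (Q.card + T.card) : ℝ) : ℂ) else 0 := by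
  have h1 : ∀ j, jointPauli Q T j k * star (jointPauli Q T j k')
      = (pauliString j.1 k.1.1 k.2.1 * pauliString j.1 k'.2.1 k'.1.1) *
        (pauliString j.2 k.2.2 k.1.2 * pauliString j.2 k'.1.2 k'.2.2) := by
    intro j
    rw [jointPauli, jointPauli, star_mul', star_pauliString_apply, star_pauliString_apply,
      mul_mul_mul_comm]
  simp only [h1, Fintype.sum_prod_type]
  rw [← Finset.sum_mul_sum, sum_pauliString_mul, sum_pauliString_mul, Fintype.card_coe,
    Fintype.card_coe]
  obtain ⟨⟨a, b⟩, c, d⟩ := k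
  obtain ⟨⟨a', b'⟩, c', d'⟩ := k'
  simp only [Prod.mk.injEq]
  push_cast
  rw [pow_add]
  split_ifs <;> first | (exfalso; tauto) | simp

theorem sum_jointPauli_reducedOutput (Q T : Finset (Fin n))
    (U : Matrix (Bits (Fin n)) (Bits (Fin n)) ℂ) (j : (Q → Fin 4) × (T → Fin 4)) :
    ∑ k, jointPauli Q T j k * reducedOutput Q T U k.1 k.2
      = (pauliCoeff U (extend T j.2) (extend Q j.1) : ℂ) := by
  rw [pauliCoeff, pauliString_isHermitianBasis.coe_basisCoeff]
  push_cast
  rw [← entangledNorm_mul_star Q]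
  have hL : ∑ k, jointPauli Q T j k * reducedOutput Q T U k.1 k.2
      = ∑ x, ∑ s, ∑ y, ∑ s', ∑ a, ∑ q, entangledNorm Q * star (entangledNorm Q) *
        (pauliString j.2 s' s * (U (glue T s q) (glue Q x a) * pauliString j.1 x y *
          star (U (glue T s' q) (glue Q y a)))) := by
    simp only [Fintype.sum_prod_type, jointPauli, reducedOutput, outputState_eq, Finset.mul_sum]
    refine Finset.sum_congr rfl fun x _ => Finset.sum_congr rfl fun s _ =>
      Finset.sum_congr rfl fun y _ => Finset.sum_congr rfl fun s' _ =>
      Finset.sum_congr rfl fun a _ => Finset.sum_congr rfl fun q _ => ?_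
    rw [star_mul']
    ring
  have hR : (pauliString (extend T j.2) * (U * pauliString (extend Q j.1) *
      U.conjTranspose)).trace = ∑ s', ∑ q, ∑ s, ∑ y, ∑ a, ∑ x,
        pauliString j.2 s' s * (U (glue T s q) (glue Q x a) * pauliString j.1 x y *
          star (U (glue T s' q) (glue Q y a))) := by
    rw [Matrix.trace, sum_bits_eq T]
    refine Finset.sum_congr rfl fun s' _ => Finset.sum_congr rfl fun q _ => ?_
    rw [Matrix.diag_apply, Matrix.mul_apply, sum_bits_eq T]
    refine Finset.sum_congr rfl fun s _ => ?_
    simp only [pauliString_extend, mul_ite, ite_mul, mul_one, mul_zero, zero_mul]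
    rw [Finset.sum_ite_eq, if_pos (Finset.mem_univ _), Matrix.mul_apply, sum_bits_eq Q,
      Finset.mul_sum]
    refine Finset.sum_congr rfl fun y _ => ?_
    rw [Finset.mul_sum]
    refine Finset.sum_congr rfl fun a _ => ?_
    rw [Matrix.mul_apply, sum_bits_eq Q, Finset.sum_mul, Finset.mul_sum]
    refine Finset.sum_congr rfl fun x _ => ?_
    simp only [pauliString_extend, mul_ite, mul_one, mul_zero]
    rw [Finset.sum_ite_eq', if_pos (Finset.mem_univ _), Matrix.conjTranspose_apply]
  rw [hL, hR, sum_permute]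
  simp only [Finset.mul_sum]

theorem sum_jointPauli_maxMixed (Q T : Finset (Fin n)) (j : (Q → Fin 4) × (T → Fin 4)) :
    ∑ k, jointPauli Q T j k * (maxMixed Q ⊗ₖ maxMixed T) k.1 k.2 = if j = 0 then 1 else 0 := by
  have htr : ∀ (V : Type) [Fintype V] [DecidableEq V] (a : V → Fin 4),
      ((2 : ℂ) ^ Fintype.card V)⁻¹ * ∑ x, pauliString a x x = if a = 0 then 1 else 0 := by
    intro V _ _ a
    have h := trace_pauliString_mul a (fun _ => 0)
    rw [pauliString_zero, Matrix.mul_one] at h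
    rw [Matrix.trace] at h
    simp only [Matrix.diag_apply] at h
    rw [h]
    have : (fun _ : V => (0 : Fin 4)) = 0 := rfl
    rw [this]
    split_ifs
    · exact inv_mul_cancel₀ (pow_ne_zero _ two_ne_zero)
    · simp
  have h1 : ∀ x s y s', (maxMixed Q ⊗ₖ maxMixed T) (x, s) (y, s')
      = if s' = s then (if y = x then ((2 : ℂ) ^ Fintype.card Q)⁻¹ * ((2 : ℂ) ^ Fintype.card T)⁻¹
        else 0) else 0 := by
    intro x s y s'
    change maxMixed Q x y * maxMixed T s s' = _
    simp only [maxMixed, Matrix.smul_apply, Matrix.one_apply, smul_eq_mul]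
    split_ifs <;> simp_all
  simp only [Fintype.sum_prod_type, jointPauli, h1, mul_ite, mul_zero, Finset.sum_ite_eq',
    Finset.mem_univ, if_true]
  have h2 := htr Q j.1
  have h3 := htr T j.2
  have h4 : (if j = 0 then (1 : ℂ) else 0)
      = (if j.1 = 0 then 1 else 0) * (if j.2 = 0 then 1 else 0) := by
    simp only [Prod.ext_iff, Prod.fst_zero, Prod.snd_zero]
    split_ifs <;> first | (exfalso; tauto) | simp
  rw [h4, ← h2, ← h3, mul_mul_mul_comm, Finset.sum_mul_sum, Finset.mul_sum]
  refine Finset.sum_congr rfl fun x _ => ?_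
  rw [Finset.mul_sum]
  refine Finset.sum_congr rfl fun s _ => ?_
  ring

/-- The trace distance from the maximally mixed state is bounded by the weights of the evolved
message Pauli strings that are supported on the accessible qubits. -/
theorem traceNorm_reducedOutput_sq_le (Q T : Finset (Fin n))
    {U : Matrix (Bits (Fin n)) (Bits (Fin n)) ℂ} (hU : U * U.conjTranspose = 1) :
    traceNorm (reducedOutput Q T U - maxMixed Q ⊗ₖ maxMixed T) ^ 2
      ≤ ∑ p : Q → Fin 4, if p = 0 then 0 else
        ∑ b : Fin n → Fin 4, if support b ⊆ T then pauliCoeff U b (extend Q p) ^ 2 else 0 := by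
  refine (traceNorm_sq_le _).trans ?_
  have hcard : (Fintype.card (Bits Q × Bits T) : ℝ) = 2 ^ (Q.card + T.card) := by
    simp [pow_add]
  rw [hcard, ← sum_norm_sq_eq (jointPauli Q T) _ (sum_jointPauli_mul_star Q T)
    (fun k => (reducedOutput Q T U - maxMixed Q ⊗ₖ maxMixed T) k.1 k.2), Fintype.sum_prod_type]
  refine Finset.sum_le_sum fun p _ => ?_
  have h1 : ∀ r : T → Fin 4, ∑ k, jointPauli Q T (p, r) k *
      (reducedOutput Q T U - maxMixed Q ⊗ₖ maxMixed T) k.1 k.2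
      = (pauliCoeff U (extend T r) (extend Q p) : ℂ)
        - if ((p, r) : (Q → Fin 4) × (T → Fin 4)) = 0 then 1 else 0 := by
    intro r
    rw [← sum_jointPauli_reducedOutput Q T U (p, r), ← sum_jointPauli_maxMixed Q T (p, r),
      ← Finset.sum_sub_distrib]
    refine Finset.sum_congr rfl fun k _ => ?_
    rw [Matrix.sub_apply, mul_sub]
  simp only [h1]
  split_ifs with hp
  · refine (Finset.sum_eq_zero fun r _ => ?_).le
    have hone : pauliString (extend Q p) = 1 := by
      rw [hp]
      exact (congrArg pauliString (extend_zero Q)).trans pauliString_zero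
    have hr : extend T r = extend Q p ↔ r = 0 := by
      have h0 : extend Q p = extend T 0 := by
        rw [hp]
        exact (extend_zero Q).trans (extend_zero T).symm
      rw [h0]
      exact (extend_injective T).eq_iff
    rw [pauliCoeff, pauliString_isHermitianBasis.basisCoeff_of_eq_one hU hone, hp]
    rw [hp] at hr
    simp only [hr, Prod.ext_iff, Prod.fst_zero, Prod.snd_zero, true_and]
    split_ifs <;> simp
  · have h2 : ∀ r : T → Fin 4, ‖(pauliCoeff U (extend T r) (extend Q p) : ℂ)
        - if ((p, r) : (Q → Fin 4) × (T → Fin 4)) = 0 then 1 else 0‖ ^ 2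
        = pauliCoeff U (extend T r) (extend Q p) ^ 2 := by
      intro r
      rw [if_neg fun h => hp (congrArg Prod.fst h), sub_zero, Complex.norm_real, Real.norm_eq_abs,
        sq_abs]
    simp only [h2]
    rw [← Finset.sum_filter]
    calc _ = ∑ b ∈ Finset.univ.image (extend T), pauliCoeff U b (extend Q p) ^ 2 := by
          rw [Finset.sum_image fun r _ r' _ h => extend_injective T h]
      _ ≤ _ := by
          refine Finset.sum_le_sum_of_subset_of_nonneg ?_ fun _ _ _ => sq_nonneg _
          intro b hb
          obtain ⟨r, -, rfl⟩ := Finset.mem_image.1 hb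
          simpa using support_extend_subset T r

end Distance

/-! ### Averaging over the accessible qubits and over the circuit -/

section Average

theorem choose_mul_pow_le {N n : ℕ} (h : N ≤ n) (c : ℕ) :
    N.choose c * n ^ c ≤ N ^ c * n.choose c := by
  induction c with
  | zero => simp
  | succ c ih =>
    have h1 : (N - c) * n ≤ N * (n - c) := by
      rw [Nat.sub_mul, Nat.mul_sub]
      exact Nat.sub_le_sub_left (by rw [mul_comm N]; exact Nat.mul_le_mul_left c h) _
    refine Nat.le_of_mul_le_mul_right ?_ (Nat.succ_pos c)
    calc N.choose (c + 1) * n ^ (c + 1) * (c + 1)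
        = N.choose (c + 1) * (c + 1) * (n ^ c * n) := by ring
      _ = N.choose c * n ^ c * ((N - c) * n) := by rw [Nat.choose_succ_right_eq]; ring
      _ ≤ N ^ c * n.choose c * (N * (n - c)) := Nat.mul_le_mul ih h1
      _ = N ^ (c + 1) * (n.choose c * (n - c)) := by ring
      _ = N ^ (c + 1) * n.choose (c + 1) * (c + 1) := by rw [← Nat.choose_succ_right_eq]; ring

variable {n : ℕ}

theorem card_supersets_le (S : Finset (Fin n)) {c : ℕ} (hc : c ≤ n) :
    (((Finset.univ : Finset (Fin n)).powersetCard (n - c)).filter fun T => S ⊆ T).card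
      ≤ (n - S.card).choose c := by
  have h1 : (Sᶜ.powersetCard c).card = (n - S.card).choose c := by
    rw [Finset.card_powersetCard, Finset.card_compl, Fintype.card_fin]
  rw [← h1]
  refine Finset.card_le_card_of_injOn (fun T => Tᶜ) ?_ fun T _ T' _ h => compl_injective h
  intro T hT
  rw [Finset.mem_coe, Finset.mem_filter, Finset.mem_powersetCard] at hT
  rw [Finset.mem_coe, Finset.mem_powersetCard]
  refine ⟨Finset.compl_subset_compl.2 hT.2, ?_⟩
  rw [Finset.card_compl, Fintype.card_fin, hT.1.2]
  omega

theorem card_supersets_div_le_one (S : Finset (Fin n)) (k : ℕ) :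
    ((((Finset.univ : Finset (Fin n)).powersetCard k).filter fun T => S ⊆ T).card : ℝ)
      / (n.choose k : ℝ) ≤ 1 := by
  refine div_le_one_of_le₀ ?_ (by positivity)
  have := Finset.card_filter_le ((Finset.univ : Finset (Fin n)).powersetCard k) fun T => S ⊆ T
  rw [Finset.card_powersetCard, Finset.card_univ, Fintype.card_fin] at this
  exact_mod_cast this

theorem card_supersets_div_le (S : Finset (Fin n)) {c : ℕ} (hc : c ≤ n) (hn : 0 < n)
    (hS : (n : ℝ) / 40 ≤ S.card) :
    ((((Finset.univ : Finset (Fin n)).powersetCard (n - c)).filter fun T => S ⊆ T).card : ℝ)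
      / (n.choose (n - c) : ℝ) ≤ (39 / 40) ^ c := by
  have hn' : (0 : ℝ) < n := by exact_mod_cast hn
  have hs : S.card ≤ n := by simpa using Finset.card_le_univ S
  have h0 : (0 : ℝ) < n.choose c := by exact_mod_cast Nat.choose_pos hc
  rw [Nat.choose_symm hc, div_le_iff₀ h0]
  have h1 : ((((Finset.univ : Finset (Fin n)).powersetCard (n - c)).filter fun T => S ⊆ T).card : ℝ)
      ≤ (n - S.card).choose c := by exact_mod_cast card_supersets_le S hc
  have h2 : ((n - S.card).choose c : ℝ) * n ^ c ≤ ((n - S.card : ℕ) : ℝ) ^ c * n.choose c := by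
    exact_mod_cast choose_mul_pow_le (Nat.sub_le n S.card) c
  have h3 : ((n - S.card : ℕ) : ℝ) ≤ 39 / 40 * n := by
    rw [Nat.cast_sub hs]
    linarith
  have h4 : ((n - S.card).choose c : ℝ) * n ^ c ≤ ((39 / 40) ^ c * n.choose c) * n ^ c := by
    refine h2.trans ?_
    calc _ ≤ (39 / 40 * (n : ℝ)) ^ c * n.choose c := by gcongr
      _ = _ := by rw [mul_pow]; ring
  exact h1.trans (le_of_mul_le_mul_right h4 (by positivity))

/-- The weight of the evolved message Pauli strings on strings of small support. -/
def smallSupportWeight (Q : Finset (Fin n)) (U : Matrix (Bits (Fin n)) (Bits (Fin n)) ℂ) : ℝ :=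
  ∑ p : Q → Fin 4, if p = 0 then 0 else
    ∑ b : Fin n → Fin 4,
      if ((support b).card : ℝ) ≤ n / 40 then pauliCoeff U b (extend Q p) ^ 2 else 0

theorem averageDistance_sq_le (Q : Finset (Fin n)) {c : ℕ} (hc : c ≤ n) (hn : 0 < n)
    {U : Matrix (Bits (Fin n)) (Bits (Fin n)) ℂ} (hU : U * U.conjTranspose = 1) :
    averageDistance Q (n - c) U ^ 2
      ≤ smallSupportWeight Q U + 4 ^ Q.card * (39 / 40) ^ c := by
  set N := fun S : Finset (Fin n) =>
    ((((Finset.univ : Finset (Fin n)).powersetCard (n - c)).filter fun T => S ⊆ T).card : ℝ)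
  set M : ℝ := (n.choose (n - c) : ℝ) with hM
  have hM0 : 0 < M := by
    rw [hM]
    exact_mod_cast Nat.choose_pos (Nat.sub_le n c)
  have hcard : ((Finset.univ : Finset (Fin n)).powersetCard (n - c)).card = n.choose (n - c) := by
    rw [Finset.card_powersetCard, Finset.card_univ, Fintype.card_fin]
  have hU' : U.conjTranspose * U = 1 := mul_eq_one_comm.1 hU
  calc averageDistance Q (n - c) U ^ 2
      = (∑ T ∈ (Finset.univ : Finset (Fin n)).powersetCard (n - c),
          traceNorm (reducedOutput Q T U - maxMixed Q ⊗ₖ maxMixed T)) ^ 2 / M ^ 2 := by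
        rw [averageDistance, div_pow]
    _ ≤ (M * ∑ T ∈ (Finset.univ : Finset (Fin n)).powersetCard (n - c),
          traceNorm (reducedOutput Q T U - maxMixed Q ⊗ₖ maxMixed T) ^ 2) / M ^ 2 := by
        have := sq_sum_le_card_mul_sum_sq (s := (Finset.univ : Finset (Fin n)).powersetCard (n - c))
          (f := fun T => traceNorm (reducedOutput Q T U - maxMixed Q ⊗ₖ maxMixed T))
        rw [hcard] at this
        exact div_le_div_of_nonneg_right this (by positivity)
    _ = (∑ T ∈ (Finset.univ : Finset (Fin n)).powersetCard (n - c),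
          traceNorm (reducedOutput Q T U - maxMixed Q ⊗ₖ maxMixed T) ^ 2) / M := by
        field_simp
    _ ≤ (∑ T ∈ (Finset.univ : Finset (Fin n)).powersetCard (n - c),
          ∑ p : Q → Fin 4, if p = 0 then 0 else ∑ b : Fin n → Fin 4,
            if support b ⊆ T then pauliCoeff U b (extend Q p) ^ 2 else 0) / M := by
        gcongr with T _
        exact traceNorm_reducedOutput_sq_le Q T hU
    _ = ∑ p : Q → Fin 4, if p = 0 then 0 else ∑ b : Fin n → Fin 4,
          N (support b) / M * pauliCoeff U b (extend Q p) ^ 2 := by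
        rw [Finset.sum_comm, Finset.sum_div]
        refine Finset.sum_congr rfl fun p _ => ?_
        split_ifs
        · simp
        rw [Finset.sum_comm, Finset.sum_div]
        refine Finset.sum_congr rfl fun b _ => ?_
        rw [← Finset.sum_filter, Finset.sum_const, nsmul_eq_mul]
        ring
    _ ≤ ∑ p : Q → Fin 4, ((if p = 0 then 0 else ∑ b : Fin n → Fin 4,
          if ((support b).card : ℝ) ≤ n / 40 then pauliCoeff U b (extend Q p) ^ 2 else 0)
            + (39 / 40) ^ c) := by
        refine Finset.sum_le_sum fun p _ => ?_
        split_ifs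
        · positivity
        have h1 : ((39 / 40 : ℝ)) ^ c
            = ∑ b : Fin n → Fin 4, (39 / 40) ^ c * pauliCoeff U b (extend Q p) ^ 2 := by
          rw [← Finset.mul_sum, pauliString_isHermitianBasis.sum_basisCoeff_sq hU', mul_one]
        conv_rhs => rw [h1]
        rw [← Finset.sum_add_distrib]
        refine Finset.sum_le_sum fun b _ => ?_
        have h2 : 0 ≤ pauliCoeff U b (extend Q p) ^ 2 := sq_nonneg _
        split_ifs with hs
        · have h3 := mul_le_mul_of_nonneg_right (card_supersets_div_le_one (support b) (n - c)) h2
          have h4 : 0 ≤ (39 / 40 : ℝ) ^ c * pauliCoeff U b (extend Q p) ^ 2 := by positivity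
          linarith
        · rw [zero_add]
          exact mul_le_mul_of_nonneg_right
            (card_supersets_div_le (support b) hc hn (not_le.1 hs).le) h2
    _ = _ := by
        rw [Finset.sum_add_distrib, smallSupportWeight]
        simp

theorem smallSupportWeight_nonneg (Q : Finset (Fin n))
    (U : Matrix (Bits (Fin n)) (Bits (Fin n)) ℂ) : 0 ≤ smallSupportWeight Q U := by
  refine Finset.sum_nonneg fun p _ => ?_
  split_ifs
  · exact le_rfl
  · exact Finset.sum_nonneg fun b _ => by positivity

theorem integrable_smallSupportWeight (𝒢 : GateModel) (t : ℕ) (Q : Finset (Fin n)) :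
    Integrable (fun w : Fin t → Layer n => smallSupportWeight Q (circuitMatrix w))
      (circuitLaw 𝒢 n t) := by
  refine integrable_finsetSum _ fun p _ => ?_
  split_ifs
  · exact integrable_zero _ _ _
  refine integrable_finsetSum _ fun b _ => ?_
  split_ifs
  · simpa only [sq] using integrable_pauliCoeff_circuitMatrix_mul 𝒢 t b b (extend Q p)
  · exact integrable_zero _ _ _

theorem sum_integral_small_support (𝒢 : GateModel) (t : ℕ) (a : Fin n → Fin 4) (r : ℝ) :
    ∑ b : Fin n → Fin 4, (if ((support b).card : ℝ) ≤ r then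
      ∫ w, pauliCoeff (circuitMatrix w) b a ^ 2 ∂(circuitLaw 𝒢 n t) else 0)
      = probSupportLE (support a) t r := by
  rw [probSupportLE]
  simp only [← sum_integral_pauliCoeff_sq 𝒢 t a]
  rw [Finset.sum_comm]
  refine Finset.sum_congr rfl fun b _ => ?_
  rw [Finset.sum_ite_eq]
  simp

theorem integral_smallSupportWeight_le (𝒢 : GateModel) {t : ℕ} (Q : Finset (Fin n)) (hn : 1 ≤ n)
    (ht : 20 * Real.log n ≤ t) :
    ∫ w : Fin t → Layer n, smallSupportWeight Q (circuitMatrix w) ∂(circuitLaw 𝒢 n t)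
      ≤ 4 ^ Q.card * (1000000 / n) := by
  have hint : ∀ (p : Q → Fin 4) (b : Fin n → Fin 4), Integrable (fun w : Fin t → Layer n =>
      if ((support b).card : ℝ) ≤ n / 40 then pauliCoeff (circuitMatrix w) b (extend Q p) ^ 2
        else 0) (circuitLaw 𝒢 n t) := by
    intro p b
    split_ifs
    · simpa only [sq] using integrable_pauliCoeff_circuitMatrix_mul 𝒢 t b b (extend Q p)
    · exact integrable_zero _ _ _
  have h1 : ∀ p : Q → Fin 4, ∫ w : Fin t → Layer n, (if p = 0 then 0 else
      ∑ b : Fin n → Fin 4, if ((support b).card : ℝ) ≤ n / 40 then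
        pauliCoeff (circuitMatrix w) b (extend Q p) ^ 2 else 0) ∂(circuitLaw 𝒢 n t)
      ≤ 1000000 / n := by
    intro p
    split_ifs with hp
    · rw [integral_zero]
      positivity
    rw [integral_finsetSum _ fun b _ => hint p b]
    have h2 : ∀ b : Fin n → Fin 4, ∫ w : Fin t → Layer n,
        (if ((support b).card : ℝ) ≤ n / 40 then pauliCoeff (circuitMatrix w) b (extend Q p) ^ 2
          else 0) ∂(circuitLaw 𝒢 n t)
        = if ((support b).card : ℝ) ≤ n / 40 then
          ∫ w, pauliCoeff (circuitMatrix w) b (extend Q p) ^ 2 ∂(circuitLaw 𝒢 n t) else 0 := by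
      intro b
      split_ifs
      · rfl
      · exact integral_zero _ _
    simp only [h2]
    rw [sum_integral_small_support]
    refine probSupportLE_le hn ?_ ht
    obtain ⟨i, hi⟩ := Function.ne_iff.1 hp
    refine ⟨i, mem_support.2 ?_⟩
    simpa [extend, i.2] using hi
  unfold smallSupportWeight
  rw [integral_finsetSum]
  · refine (Finset.sum_le_sum fun p _ => h1 p).trans_eq ?_
    simp
  · intro p _
    split_ifs
    · exact integrable_zero _ _ _
    · exact integrable_finsetSum _ fun b _ => hint p b

theorem averageDistance_tail_le (𝒢 : GateModel) {t c : ℕ} (Q : Finset (Fin n)) (hn : 1 ≤ n)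
    (hc : c ≤ n) (ht : 20 * Real.log n ≤ t) {ε : ℝ} (hε : 0 < ε)
    (hcε : (4 : ℝ) ^ Q.card * (39 / 40) ^ c ≤ ε ^ 2 / 2) :
    (circuitLaw 𝒢 n t).real {w | ε < averageDistance Q (n - c) (circuitMatrix w)}
      ≤ 2 / ε ^ 2 * (4 ^ Q.card * (1000000 / n)) := by
  have h1 : (circuitLaw 𝒢 n t).real {w | ε < averageDistance Q (n - c) (circuitMatrix w)}
      ≤ (circuitLaw 𝒢 n t).real {w | ε ^ 2 / 2 ≤ smallSupportWeight Q (circuitMatrix w)} := by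
    refine measureReal_mono fun w hw => ?_
    have h2 := averageDistance_sq_le Q hc hn (circuitMatrix_mul_conjTranspose w)
    have h3 : ε ^ 2 < averageDistance Q (n - c) (circuitMatrix w) ^ 2 :=
      pow_lt_pow_left₀ hw hε.le two_ne_zero
    change ε ^ 2 / 2 ≤ _
    linarith
  have h2 := mul_meas_ge_le_integral_of_nonneg
    (ae_of_all _ fun w => smallSupportWeight_nonneg Q (circuitMatrix w))
    (integrable_smallSupportWeight 𝒢 t Q) (ε ^ 2 / 2)
  have h3 := h2.trans (integral_smallSupportWeight_le 𝒢 Q hn ht)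
  have hε2 : 0 < ε ^ 2 / 2 := by positivity
  refine h1.trans ?_
  rw [← inv_div (ε ^ 2) 2, inv_mul_eq_div, le_div_iff₀ hε2, mul_comm]
  exact h3

theorem inv_le_log_cube {n : ℕ} (hn : 2 ≤ n) :
    1 / (n : ℝ) ≤ 1 / Real.log 2 ^ 3 * (Real.log n ^ 3 / n) := by
  have hn' : (2 : ℝ) ≤ n := by exact_mod_cast hn
  have h2 : 0 < Real.log 2 := Real.log_pos one_lt_two
  have h3 : Real.log 2 ≤ Real.log n := Real.log_le_log two_pos hn'
  rw [← mul_div_assoc]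
  refine div_le_div_of_nonneg_right ?_ (by positivity)
  rw [one_div, inv_mul_eq_div, le_div_iff₀ (by positivity), one_mul]
  exact pow_le_pow_left₀ h2.le h3 3

end Average

end Scrambling

end

theorem mainTheorem3 :
    (∃ K : ℝ, ∃ f₀ : ℝ, 0 < f₀ ∧ ∃ C : ℝ, ∀ f : ℝ, f ≤ f₀ →
      ∀ n : ℕ, 2 ≤ n → ∀ i : Fin n, ∀ t : ℕ, K * Real.log n ≤ t →
        Scrambling.probSupportLE {i} t (f * n) ≤ C * (Real.log n ^ 3 / n)) ∧
    (∃ K : ℝ, ∀ (m : ℕ) (ε : ℝ), 0 < ε → ∃ (c₀ : ℕ) (C : ℝ),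
      ∀ n : ℕ, 2 ≤ n → ∀ c : ℕ, c₀ ≤ c → c ≤ n → ∀ t : ℕ, K * Real.log n ≤ t →
        ∀ (𝒢 : Scrambling.GateModel) (Q : Finset (Fin n)), Q.card = m →
          (Scrambling.circuitLaw 𝒢 n t).real
              {w | ε < Scrambling.averageDistance Q (n - c) (Scrambling.circuitMatrix w)}
            ≤ C * (Real.log n ^ 3 / n)) := by
  refine ⟨⟨20, 1 / 40, by norm_num, 1000000 * (1 / Real.log 2 ^ 3), ?_⟩, 20, ?_⟩
  · intro f hf n hn i t ht
    have h1 : f * n ≤ n / 40 := by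
      have := mul_le_mul_of_nonneg_right hf (Nat.cast_nonneg (α := ℝ) n)
      linarith
    calc _ ≤ Scrambling.probSupportLE {i} t (n / 40) := Scrambling.probSupportLE_mono _ t h1
      _ ≤ 1000000 / n :=
        Scrambling.probSupportLE_le (by omega) (Finset.singleton_nonempty i) ht
      _ = 1000000 * (1 / n) := by ring
      _ ≤ 1000000 * (1 / Real.log 2 ^ 3 * (Real.log n ^ 3 / n)) :=
        mul_le_mul_of_nonneg_left (Scrambling.inv_le_log_cube hn) (by norm_num)
      _ = _ := by ring
  · intro m ε hε
    obtain ⟨c₀, hc₀⟩ := exists_pow_lt_of_lt_one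
      (show (0 : ℝ) < ε ^ 2 / 2 / 4 ^ m by positivity) (show (39 / 40 : ℝ) < 1 by norm_num)
    refine ⟨c₀, 2 / ε ^ 2 * (4 ^ m * 1000000) * (1 / Real.log 2 ^ 3), ?_⟩
    intro n hn c hc hcn t ht 𝒢 Q hQ
    have h1 : (4 : ℝ) ^ Q.card * (39 / 40) ^ c ≤ ε ^ 2 / 2 := by
      have h2 : (39 / 40 : ℝ) ^ c ≤ (39 / 40) ^ c₀ :=
        pow_le_pow_of_le_one (by norm_num) (by norm_num) hc
      rw [hQ, mul_comm]
      exact (le_div_iff₀ (by positivity)).1 (h2.trans hc₀.le)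
    calc _ ≤ 2 / ε ^ 2 * (4 ^ Q.card * (1000000 / n)) :=
          Scrambling.averageDistance_tail_le 𝒢 Q (by omega) hcn ht hε h1
      _ = 2 / ε ^ 2 * (4 ^ m * 1000000) * (1 / n) := by rw [hQ]; ring
      _ ≤ 2 / ε ^ 2 * (4 ^ m * 1000000) * (1 / Real.log 2 ^ 3 * (Real.log n ^ 3 / n)) :=
        mul_le_mul_of_nonneg_left (Scrambling.inv_le_log_cube hn) (by positivity)
      _ = _ := by ring
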